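/- Let $d\ge 2$ be an integer. There is a constant $C_d>0$, depending only on $d$, such that the following holds. Let $\mathcal S$ be a finite collection (repetitions allowed) of $n\neq 1$ spheres in $\mathbb R^d$, where a sphere is a set $\{x\in\mathbb R^d:\|x-c\|=r\}$ with $c\in\mathbb R^d$ and $r>0$. Let $G(\mathcal S)$ be the intersection graph of $\mathcal S$: its vertices are the members of $\mathcal S$, and two different members are adjacent if they have a common point. Write $\deg(S)$ for the degree of $S$ in $G(\mathcal S)$ and $m$ for the number of edges of $G(\mathcal S)$. A balanced separator of a finite graph $G=(V,E)$ is a set $\mathcal X\subseteq V$ such that every connected component of $G\setminus\mathcal X$ has at most $\tfrac23|V|$ vertices. Then: 1. $G(\mathcal S)$ has a balanced separator of size at most $$C_d\left(\sum_{S\in\mathcal S}\deg(S)^{\frac1{d-1}}\right)^{1-\frac1d};$$ 2. $G(\mathcal S)$ has a balanced separator of size at most $C_d\, m^{1/d}\, n^{1-2/d}$. -/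

import Mathlib

/-- The intersection graph of a family `A` of sets: the vertices are the indices, and two distinct
indices are adjacent when the corresponding sets have a common point. -/
def intersectionGraph {V E : Type*} (A : V → Set E) : SimpleGraph V where
  Adj i j := i ≠ j ∧ (A i ∩ A j).Nonempty
  symm := ⟨fun _ _ h => ⟨h.1.symm, by rw [Set.inter_comm]; exact h.2⟩⟩
  loopless := ⟨fun _ h => h.1 rfl⟩

noncomputable instance {V E : Type*} (A : V → Set E) : DecidableRel (intersectionGraph A).Adj :=
  Classical.decRel _

/-- The intersection graph of a family of spheres in `ℝ^d`. A sphere is the hypersurface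
`{x | dist x c = r}`, not the ball that it bounds. -/
abbrev sphereGraph {d : ℕ} {V : Type*}
    (S : V → EuclideanGeometry.Sphere (EuclideanSpace ℝ (Fin d))) : SimpleGraph V :=
  intersectionGraph fun i => Metric.sphere (S i).center (S i).radius

/-- A balanced separator of a finite graph `G = (V, E)`: a vertex set `X` such that every connected
component of `G \ X` has at most `2|V|/3` vertices. -/
def IsBalancedSeparator {V : Type*} [Fintype V] (G : SimpleGraph V) (X : Finset V) : Prop :=
  ∀ K : (G.induce {v : V | v ∉ X}).ConnectedComponent,
    (K.supp.ncard : ℝ) ≤ 2 / 3 * (Fintype.card V : ℝ)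

/-!
The two bounds hold for the same separator, the second because
`∑ deg ^ (1 / (d - 1)) ≤ n ^ (1 - 1 / (d - 1)) * (2 m) ^ (1 / (d - 1))` by the power mean inequality
(`degreeSum_rpow_le`).

It suffices to find, for every set `A` of at least two spheres, a set of `O(N ^ (1 - 1 / d))`
spheres, `N = ∑ deg ^ (1 / (d - 1))`, whose removal leaves a proportion bounded away from `1` of `A`
in every component (`exists_proportional_separator`); applying this to the large component a bounded
number of times gives a balanced separator (`exists_iterated_separator`). If `A` is small, its
non-isolated members can be removed. Otherwise choose distinct points on
the spheres, and a ball of radius `R` about some `c` that contains a fixed proportion of the points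
of `A` such that the concentric ball of radius `2R` contains at most half of them (`exists_window`).
Cutting along the sphere of radius `t` about `c`, for a random `t ∈ [R, 2R]`, and removing all
spheres that it meets would be the usual proof for balls. It is too expensive here: many nested
spheres without any intersection may be met at the same time.

To remedy this, let `E v` be the side of the sphere `v` (interior or exterior) that contains at most
half of the points of `A`, and collapse the sides of some spheres. Let `D` be a random set that
contains each non-isolated `v` independently with probability `1 / (2 deg v)`, and call `v` exposed
if no `u ∈ D` has `closure (E v) ⊆ E u`. Remove the exposed non-isolated spheres `v` for which
`closure (E v)` meets the cutting sphere, and the neighbours of those among them that are in `D`.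
A remaining component is a single vertex, or lies inside or outside the cutting sphere, or is
confined to `E u` for some exposed `u ∈ D`
(`IsConnectedSet.confined_of_disjoint_removedVertices`).

The expected number of neighbours removed for `v` is at most the probability that `v` is exposed, so
the expected cost is `O(∑ P v * τ v)`, where `P v` is the probability that `v` is exposed and `τ v`
the probability that `closure (E v)` meets the cutting sphere. The main point is that
`∑ P v / (2 deg v) ≤ 2` when the sum extends over the `v` whose side contains a given point
(`sum_samplingProb_mul_exposureProb_le`): sides of disjoint spheres with a common point are nested,
as two sides never cover the space, so an independent subset of `D` has at most one exposed member
around a point. As `E v` contains a ball of radius proportional to `τ v * R` near the window,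
integrating over the window gives `∑ P v / deg v * τ v ^ d = O(1)`
(`sum_mul_pow_le_of_ball_subset`), and Hölder's inequality turns this into
`∑ P v * τ v = O(N ^ (1 - 1 / d))` (`sum_mul_le_rpow_mul_rpow`).
-/

/-! ### Random subsets with independent membership -/

/-- The probability that a random subset of `V`, containing each `v` independently with
probability `q v`, is equal to `D`. -/
noncomputable def bernoulliWeight {V : Type*} [Fintype V] [DecidableEq V] (q : V → ℝ)
    (D : Finset V) : ℝ :=
  (∏ v ∈ D, q v) * ∏ v ∈ Finset.univ \ D, (1 - q v)

theorem one_sub_sum_le_prod_one_sub {V : Type*} {q : V → ℝ} (h0 : ∀ v, 0 ≤ q v) (h1 : ∀ v, q v ≤ 1)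
    (s : Finset V) : 1 - ∑ v ∈ s, q v ≤ ∏ v ∈ s, (1 - q v) := by
  classical
  induction s using Finset.induction_on with
  | empty => simp
  | insert a s ha ih =>
    rw [Finset.sum_insert ha, Finset.prod_insert ha]
    have hp : ∏ v ∈ s, (1 - q v) ≤ 1 :=
      Finset.prod_le_one (fun v _ => sub_nonneg.2 (h1 v)) fun v _ => by linarith [h0 v]
    nlinarith [h0 a, h1 a]

section Bernoulli

variable {V : Type*} [Fintype V] [DecidableEq V] {q : V → ℝ}

theorem bernoulliWeight_nonneg (h0 : ∀ v, 0 ≤ q v) (h1 : ∀ v, q v ≤ 1) (D : Finset V) :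
    0 ≤ bernoulliWeight q D :=
  mul_nonneg (Finset.prod_nonneg fun v _ => h0 v)
    (Finset.prod_nonneg fun v _ => sub_nonneg.2 (h1 v))

theorem sum_bernoulliWeight (q : V → ℝ) : ∑ D, bernoulliWeight q D = 1 := by
  have h := Finset.prod_add q (fun v => 1 - q v) Finset.univ
  simp only [add_sub_cancel, Finset.prod_const_one, Finset.powerset_univ] at h
  exact h.symm

/-- The probability that a random subset contains `A` and avoids `B`. -/
theorem sum_bernoulliWeight_subset_disjoint (q : V → ℝ) {A B : Finset V} (hAB : Disjoint A B) :
    ∑ D, (if A ⊆ D ∧ Disjoint D B then bernoulliWeight q D else 0) =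
      (∏ v ∈ A, q v) * ∏ v ∈ B, (1 - q v) := by
  have h := Finset.prod_add (fun v => if v ∈ B then 0 else q v)
    (fun v => if v ∈ A then 0 else 1 - q v) Finset.univ
  rw [Finset.powerset_univ] at h
  calc _ = _ := ?_
    _ = _ := h.symm
    _ = _ := ?_
  · refine Finset.sum_congr rfl fun D _ => ?_
    unfold bernoulliWeight
    split_ifs with hD
    · congr 1
      · exact Finset.prod_congr rfl fun v hv =>
          (if_neg (Finset.disjoint_left.1 hD.2 hv)).symm
      · exact Finset.prod_congr rfl fun v hv =>
          (if_neg fun hA => (Finset.mem_sdiff.1 hv).2 (hD.1 hA)).symm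
    · rcases not_and_or.1 hD with hD | hD
      · obtain ⟨v, hvA, hvD⟩ := Finset.not_subset.1 hD
        have h0 : ∏ v ∈ Finset.univ \ D, (if v ∈ A then 0 else 1 - q v) = 0 :=
          Finset.prod_eq_zero (i := v) (by simpa using hvD) (if_pos hvA)
        rw [h0, mul_zero]
      · obtain ⟨v, hvD, hvB⟩ := Finset.not_disjoint_iff.1 hD
        have h0 : ∏ v ∈ D, (if v ∈ B then 0 else q v) = 0 :=
          Finset.prod_eq_zero (i := v) hvD (if_pos hvB)
        rw [h0, zero_mul]
  · rw [← Finset.prod_subset (Finset.subset_univ (A ∪ B)), Finset.prod_union hAB]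
    · congr 1
      · exact Finset.prod_congr rfl fun v hv => by
          simp [hv, Finset.disjoint_left.1 hAB hv]
      · exact Finset.prod_congr rfl fun v hv => by
          simp [hv, Finset.disjoint_right.1 hAB hv]
    · intro v _ hv
      simp only [Finset.mem_union, not_or] at hv
      simp [hv.1, hv.2]

/-- First moment method: some subset is at most as large as the average over random subsets. -/
theorem exists_le_of_sum_bernoulliWeight_mul_le (h0 : ∀ v, 0 ≤ q v) (h1 : ∀ v, q v ≤ 1)
    (f : Finset V → ℝ) {c : ℝ} (h : ∑ D, bernoulliWeight q D * f D ≤ c) : ∃ D, f D ≤ c := by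
  by_contra! hc
  have hpos : ∃ D, 0 < bernoulliWeight q D := by
    by_contra! hn
    have := sum_bernoulliWeight q
    linarith [Finset.sum_nonpos fun D (_ : D ∈ Finset.univ) => hn D]
  obtain ⟨D₀, hD₀⟩ := hpos
  have : ∑ D, bernoulliWeight q D * c < ∑ D, bernoulliWeight q D * f D :=
    Finset.sum_lt_sum
      (fun D _ => mul_le_mul_of_nonneg_left (hc D).le (bernoulliWeight_nonneg h0 h1 D))
      ⟨D₀, Finset.mem_univ _, mul_lt_mul_of_pos_left (hc D₀) hD₀⟩
  rw [← Finset.sum_mul, sum_bernoulliWeight, one_mul] at this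
  linarith

end Bernoulli

/-! ### Sides of a separating hypersurface -/

/-- `S` is a connected closed hypersurface that cuts the space into two connected open sides
`E` and `F`, each of which accumulates at every point of `S`. -/
structure IsSidePair {X : Type*} [TopologicalSpace X] (S E F : Set X) : Prop where
  nonempty : S.Nonempty
  isPreconnected : IsPreconnected S
  isOpen_left : IsOpen E
  isOpen_right : IsOpen F
  isPreconnected_left : IsPreconnected E
  isPreconnected_right : IsPreconnected F
  disjoint_left : Disjoint S E
  disjoint_right : Disjoint S F
  disjoint_sides : Disjoint E F
  cover : ∀ x, x ∈ S ∨ x ∈ E ∨ x ∈ F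
  subset_closure_left : S ⊆ closure E
  subset_closure_right : S ⊆ closure F

namespace IsSidePair

variable {X : Type*} [TopologicalSpace X] {S E F S' E' F' : Set X}

theorem symm (h : IsSidePair S E F) : IsSidePair S F E :=
  ⟨h.nonempty, h.isPreconnected, h.isOpen_right, h.isOpen_left, h.isPreconnected_right,
    h.isPreconnected_left, h.disjoint_right, h.disjoint_left, h.disjoint_sides.symm,
    fun x => (h.cover x).imp_right Or.symm, h.subset_closure_right, h.subset_closure_left⟩

theorem closure_left (h : IsSidePair S E F) : closure E = E ∪ S := by
  refine Set.Subset.antisymm (fun x hx => ?_) (Set.union_subset subset_closure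
    h.subset_closure_left)
  rcases h.cover x with hS | hE | hF
  · exact Or.inr hS
  · exact Or.inl hE
  · obtain ⟨y, hyF, hyE⟩ := mem_closure_iff.1 hx F h.isOpen_right hF
    exact absurd hyF (Set.disjoint_left.1 h.disjoint_sides hyE)

/-- A connected set that misses `S` lies on one side. -/
theorem subset_or_subset (h : IsSidePair S E F) {T : Set X} (hT : IsPreconnected T)
    (hTS : Disjoint T S) : T ⊆ E ∨ T ⊆ F :=
  hT.subset_or_subset h.isOpen_left h.isOpen_right h.disjoint_sides fun x hx =>
    (h.cover x).resolve_left fun hS => Set.disjoint_left.1 hTS hx hS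

theorem subset_left (h : IsSidePair S E F) {T : Set X} (hT : IsPreconnected T)
    (hTS : Disjoint T S) {x : X} (hxT : x ∈ T) (hxE : x ∈ E) : T ⊆ E :=
  (h.subset_or_subset hT hTS).resolve_right fun hF =>
    Set.disjoint_left.1 h.disjoint_sides hxE (hF hxT)

/-- If two disjoint hypersurfaces have sides with a common point, then these sides are nested or
cover the space. -/
theorem trichotomy (h : IsSidePair S E F) (h' : IsSidePair S' E' F') (hSS : Disjoint S S')
    {x : X} (hx : x ∈ E) (hx' : x ∈ E') :
    closure E ⊆ E' ∨ closure E' ⊆ E ∨ E ∪ E' = Set.univ := by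
  rcases h.subset_or_subset h'.isPreconnected hSS.symm with h1 | h1
  · rcases h'.subset_or_subset h.isPreconnected hSS with h2 | h2
    · refine Or.inr (Or.inr (Set.eq_univ_of_forall fun y => ?_))
      have hFS' : Disjoint F S' :=
        (Set.disjoint_of_subset_left h1 h.disjoint_sides).symm
      have hFE' : F ⊆ E' := by
        rcases h'.subset_or_subset h.isPreconnected_right hFS' with h3 | h3
        · exact h3
        · obtain ⟨z, hz⟩ := h.nonempty
          obtain ⟨w, hw, hwF⟩ := mem_closure_iff.1 (h.subset_closure_right hz) E' h'.isOpen_left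
            (h2 hz)
          exact absurd (h3 hwF) (Set.disjoint_left.1 h'.disjoint_sides hw)
      rcases h.cover y with hy | hy | hy
      · exact Or.inr (h2 hy)
      · exact Or.inl hy
      · exact Or.inr (hFE' hy)
    · refine Or.inr (Or.inl ?_)
      have hd : Disjoint E' S := (Set.disjoint_of_subset_left h2 h'.disjoint_sides.symm).symm
      rw [h'.closure_left]
      exact Set.union_subset (h.subset_left h'.isPreconnected_left hd hx' hx) h1
  · have hd : Disjoint E S' := (Set.disjoint_of_subset_left h1 h.disjoint_sides.symm).symm
    have hE : E ⊆ E' := h'.subset_left h.isPreconnected_left hd hx hx'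
    refine Or.inl ?_
    rw [h.closure_left]
    refine Set.union_subset hE ?_
    rcases h'.subset_or_subset h.isPreconnected hSS with h2 | h2
    · exact h2
    · obtain ⟨z, hz⟩ := h.nonempty
      obtain ⟨w, hw, hwE⟩ := mem_closure_iff.1 (h.subset_closure_left hz) F' h'.isOpen_right
        (h2 hz)
      exact absurd hw (Set.disjoint_left.1 h'.disjoint_sides (hE hwE))

end IsSidePair

/-! ### The two sides of a sphere -/

section SphereSides

variable {E : Type*} [NormedAddCommGroup E] [NormedSpace ℝ E]

theorem isPreconnected_compl_closedBall (h : 1 < Module.rank ℝ E) (z : E) {r : ℝ} (hr : 0 < r) :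
    IsPreconnected (Metric.closedBall z r)ᶜ := by
  -- radial push of the punctured space away from the centre
  have himg : (fun y : E => z + (1 + r * ‖y‖⁻¹) • y) '' {0}ᶜ = (Metric.closedBall z r)ᶜ := by
    apply Set.Subset.antisymm
    · rintro - ⟨y, hy, rfl⟩
      have hy0 : 0 < ‖y‖ := norm_pos_iff.2 hy
      have hn : ‖(1 + r * ‖y‖⁻¹) • y‖ = ‖y‖ + r := by
        rw [norm_smul, Real.norm_eq_abs, abs_of_pos (by positivity)]
        field_simp
      simp only [Set.mem_compl_iff, mem_closedBall_iff_norm, add_sub_cancel_left, hn]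
      linarith
    · intro x hx
      simp only [Set.mem_compl_iff, mem_closedBall_iff_norm, not_le] at hx
      have hx0 : 0 < ‖x - z‖ := hr.trans hx
      have hc : 0 < 1 - r * ‖x - z‖⁻¹ := by
        have : r * ‖x - z‖⁻¹ < 1 := by
          rw [← div_eq_mul_inv, div_lt_one hx0]; exact hx
        linarith
      have hn : ‖(1 - r * ‖x - z‖⁻¹) • (x - z)‖ = ‖x - z‖ - r := by
        rw [norm_smul, Real.norm_eq_abs, abs_of_pos hc]
        field_simp
      refine ⟨(1 - r * ‖x - z‖⁻¹) • (x - z), ?_, ?_⟩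
      · simp only [Set.mem_compl_iff, Set.mem_singleton_iff]
        rw [← norm_eq_zero, hn]
        exact ne_of_gt (by linarith)
      · have hne : ‖x - z‖ - r ≠ 0 := by linarith
        have hco : (1 + r * (‖x - z‖ - r)⁻¹) * (1 - r * ‖x - z‖⁻¹) = 1 := by
          field_simp
          ring
        simp only [hn, smul_smul, hco, one_smul, add_sub_cancel]
  rw [← himg]
  refine (isConnected_compl_singleton_of_one_lt_rank h 0).isPreconnected.image _ ?_
  intro y hy
  have hy0 : ‖y‖ ≠ 0 := norm_ne_zero_iff.2 hy
  exact (continuousAt_const.add ((continuousAt_const.add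
    (continuousAt_const.mul (continuousAt_id.norm.inv₀ hy0))).smul
      continuousAt_id)).continuousWithinAt

theorem isSidePair_sphere (h : 1 < Module.rank ℝ E) (z : E) {r : ℝ} (hr : 0 < r) :
    IsSidePair (Metric.sphere z r) (Metric.ball z r) (Metric.closedBall z r)ᶜ where
  nonempty := (isConnected_sphere h z hr.le).nonempty
  isPreconnected := isPreconnected_sphere h z r
  isOpen_left := Metric.isOpen_ball
  isOpen_right := Metric.isClosed_closedBall.isOpen_compl
  isPreconnected_left := (convex_ball z r).isPreconnected
  isPreconnected_right := isPreconnected_compl_closedBall h z hr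
  disjoint_left := Metric.sphere_disjoint_ball
  disjoint_right := Set.disjoint_compl_right_iff_subset.2 Metric.sphere_subset_closedBall
  disjoint_sides := Set.disjoint_compl_right_iff_subset.2 Metric.ball_subset_closedBall
  cover x := by
    simp only [Metric.mem_sphere, Metric.mem_ball, Set.mem_compl_iff, Metric.mem_closedBall, not_le]
    rcases lt_trichotomy (dist x z) r with h | h | h <;> simp [h]
  subset_closure_left := by
    rw [closure_ball z hr.ne']
    exact Metric.sphere_subset_closedBall
  subset_closure_right := by
    rw [closure_compl, interior_closedBall z hr.ne', Set.subset_compl_iff_disjoint_right]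
    exact Metric.sphere_disjoint_ball

/-- An open ball that reaches into the ball of radius `2R` about `c` contains a ball in the ball of
radius `4R` whose radius `s` is comparable with the length of the set of radii `t ∈ [R, 2R]` for
which the sphere of radius `t` about `c` meets the given ball. -/
theorem exists_ball_subset_ball_inter (z c : E) {r R : ℝ} (hr : 0 < r) (hR : 0 < R) :
    ∃ a s : ℝ, 0 ≤ s ∧
      (∀ t ∈ Set.Icc R (2 * R), (closure (Metric.ball z r) ∩ Metric.sphere c t).Nonempty →
        t ∈ Set.Icc a (a + 2 * s)) ∧
      ∃ y, Metric.ball y s ⊆ Metric.ball z r ∩ Metric.ball c (4 * R) := by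
  rw [closure_ball z hr.ne']
  by_cases hne : ∃ t ∈ Set.Icc R (2 * R), (Metric.closedBall z r ∩ Metric.sphere c t).Nonempty
  swap
  · push Not at hne
    refine ⟨0, 0, le_rfl, fun t ht h => absurd (hne t ht) h.ne_empty, c, by simp⟩
  obtain ⟨t₀, ht₀, y, hyz, hyc⟩ := hne
  rw [Metric.mem_closedBall, dist_eq_norm] at hyz
  rw [Metric.mem_sphere, dist_eq_norm] at hyc
  have hs : 0 < min r R := lt_min hr hR
  refine ⟨if r ≤ R then dist z c - r else R, min r R, hs.le, ?_, ?_⟩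
  · rintro t ht ⟨x, hxz, hxc⟩
    rw [Metric.mem_closedBall] at hxz
    rw [Metric.mem_sphere] at hxc
    split_ifs with h
    · rw [min_eq_left h]
      have h1 := dist_triangle x z c
      have h2 := dist_triangle z x c
      rw [dist_comm z x] at h2
      constructor <;> linarith
    · rw [min_eq_right (not_le.1 h).le]
      exact ⟨ht.1, by linarith [ht.2]⟩
  · -- move from `y` towards the centre `z` by at most `s`
    have hk1 : min r R / r ≤ 1 := (div_le_one hr).2 (min_le_left _ _)
    have hk0 : 0 < min r R / r := div_pos hs hr
    have hkr : min r R / r * r = min r R := div_mul_cancel₀ _ hr.ne'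
    refine ⟨y + (min r R / r) • (z - y), Set.subset_inter ?_ ?_⟩
    · refine Metric.ball_subset_ball' ?_
      have : y + (min r R / r) • (z - y) - z = (1 - min r R / r) • (y - z) := by
        module
      rw [dist_eq_norm, this, norm_smul, Real.norm_eq_abs, abs_of_nonneg (by linarith)]
      nlinarith
    · refine Metric.ball_subset_ball' ?_
      have h1 : ‖(min r R / r) • (z - y)‖ ≤ min r R := by
        rw [norm_smul, Real.norm_eq_abs, abs_of_pos hk0, norm_sub_rev]
        nlinarith
      have h2 : ‖y + (min r R / r) • (z - y) - c‖ ≤ ‖y - c‖ + ‖(min r R / r) • (z - y)‖ := by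
        rw [add_sub_right_comm]
        exact norm_add_le _ _
      rw [dist_eq_norm]
      linarith [ht₀.2, min_le_right r R]

/-- The analogue of `exists_ball_subset_ball_inter` for the exterior of a ball. -/
theorem exists_ball_subset_compl_closedBall_inter (z c : E) {r R : ℝ} (hr : 0 < r) (hR : 0 < R) :
    ∃ a s : ℝ, 0 ≤ s ∧
      (∀ t ∈ Set.Icc R (2 * R),
        (closure (Metric.closedBall z r)ᶜ ∩ Metric.sphere c t).Nonempty →
          t ∈ Set.Icc a (a + 2 * s)) ∧
      ∃ y, Metric.ball y s ⊆ (Metric.closedBall z r)ᶜ ∩ Metric.ball c (4 * R) := by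
  by_cases hne : ∃ t ∈ Set.Icc R (2 * R),
    (closure (Metric.closedBall z r)ᶜ ∩ Metric.sphere c t).Nonempty
  swap
  · push Not at hne
    refine ⟨0, 0, le_rfl, fun t ht h => absurd (hne t ht) h.ne_empty, c, by simp⟩
  obtain ⟨t₀, ht₀, y, hyz, hyc⟩ := hne
  have hzy : r ≤ ‖y - z‖ := by
    have h1 : y ∈ {x | r ≤ dist x z} := by
      refine closure_minimal ?_ (isClosed_le continuous_const (continuous_id.dist continuous_const))
        hyz
      intro x hx
      simp only [Set.mem_compl_iff, Metric.mem_closedBall, not_le] at hx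
      exact hx.le
    rw [← dist_eq_norm]
    exact h1
  rw [Metric.mem_sphere, dist_eq_norm] at hyc
  have hpos : 0 < ‖y - z‖ := hr.trans_le hzy
  refine ⟨R, R, hR.le, fun t ht _ => ⟨ht.1, by linarith [ht.2]⟩,
    y + (R / ‖y - z‖) • (y - z), Set.subset_inter ?_ ?_⟩
  · -- the ball of radius `R` tangent at `y` to the sphere through `y` about `z`
    intro x hx
    rw [Metric.mem_ball, dist_eq_norm] at hx
    simp only [Set.mem_compl_iff, Metric.mem_closedBall, not_le, dist_eq_norm]
    have h1 : ‖y + (R / ‖y - z‖) • (y - z) - z‖ = ‖y - z‖ + R := by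
      have : y + (R / ‖y - z‖) • (y - z) - z = (1 + R / ‖y - z‖) • (y - z) := by module
      rw [this, norm_smul, Real.norm_eq_abs, abs_of_pos (by positivity)]
      field_simp
    have h2 := norm_sub_le_norm_sub_add_norm_sub (y + (R / ‖y - z‖) • (y - z)) x z
    rw [norm_sub_rev _ x] at h2
    linarith
  · refine Metric.ball_subset_ball' ?_
    have h1 : ‖(R / ‖y - z‖) • (y - z)‖ = R := by
      rw [norm_smul, Real.norm_eq_abs, abs_of_pos (by positivity)]
      field_simp
    have h2 : ‖y + (R / ‖y - z‖) • (y - z) - c‖ ≤ ‖y - c‖ + ‖(R / ‖y - z‖) • (y - z)‖ := by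
      rw [add_sub_right_comm]
      exact norm_add_le _ _
    rw [dist_eq_norm]
    linarith [ht₀.2]

end SphereSides

/-! ### A window of bounded concentration -/

section Window

variable {E : Type*} [NormedAddCommGroup E]

theorem exists_finset_cover_closedBall [ProperSpace E] :
    ∃ T : Finset E, Metric.closedBall (0 : E) 4 ⊆ ⋃ x ∈ T, Metric.closedBall x 1 := by
  obtain ⟨T, hT⟩ := (isCompact_closedBall (0 : E) 4).elim_nhds_subcover
    (fun x => Metric.closedBall x 1) fun x _ => Metric.closedBall_mem_nhds x one_pos
  exact ⟨T, hT.2⟩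

open Classical in
/-- Finitely many distinct points admit a ball of some radius `R` that contains a fixed proportion
of them while no ball of radius `R / 2` does; covering a ball of radius `2R` by balls of radius
`R / 2` then bounds the number of points in the former. -/
theorem exists_window [NormedSpace ℝ E] (T : Finset E)
    (hT : Metric.closedBall (0 : E) 4 ⊆ ⋃ x ∈ T, Metric.closedBall x 1)
    {V : Type*} (A : Finset V) (p : V → E) (hp : Function.Injective p) (hA : 2 * T.card < A.card) :
    ∃ (c : E) (R : ℝ), 0 < R ∧
      A.card ≤ 2 * T.card * (A.filter fun v => p v ∈ Metric.closedBall c R).card ∧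
      2 * (A.filter fun v => p v ∈ Metric.closedBall c (2 * R)).card ≤ A.card := by
  have hT0 : 0 < T.card := by
    obtain ⟨x, hx, -⟩ := Set.mem_iUnion₂.1 (hT (Metric.mem_closedBall_self (by norm_num)))
    exact Finset.card_pos.2 ⟨x, hx⟩
  let N : E → ℝ → ℕ := fun c ρ => (A.filter fun v => p v ∈ Metric.closedBall c ρ).card
  -- a ball containing all the points
  obtain ⟨ρ₀, hρ₀, hall⟩ : ∃ ρ₀ : ℝ, 0 < ρ₀ ∧ ∀ v ∈ A, ‖p v‖ ≤ ρ₀ := by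
    obtain ⟨M, hM⟩ := (A.finite_toSet.image fun v => ‖p v‖).bddAbove
    exact ⟨max M 1, lt_max_of_lt_right one_pos,
      fun v hv => (hM ⟨v, hv, rfl⟩).trans (le_max_left _ _)⟩
  -- the least distance of two of the points
  obtain ⟨ε, hε, hsep⟩ : ∃ ε : ℝ, 0 < ε ∧ ∀ v ∈ A, ∀ w ∈ A, v ≠ w → ε ≤ dist (p v) (p w) := by
    obtain ⟨v, hv, w, hw, hvw⟩ := Finset.one_lt_card.1 (show 1 < A.card by omega)
    obtain ⟨e, he, hmin⟩ := A.offDiag.exists_min_image (fun e => dist (p e.1) (p e.2))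
      ⟨(v, w), Finset.mem_offDiag.2 ⟨hv, hw, hvw⟩⟩
    exact ⟨_, dist_pos.2 (hp.ne (Finset.mem_offDiag.1 he).2.2), fun v hv w hw hvw =>
      hmin (v, w) (Finset.mem_offDiag.2 ⟨hv, hw, hvw⟩)⟩
  have hsmall : ∃ k : ℕ, ¬ ∃ c, A.card ≤ 2 * T.card * N c ((1 / 2) ^ k * ρ₀) := by
    obtain ⟨k, hk⟩ := exists_pow_lt_of_lt_one (show 0 < ε / (2 * ρ₀) by positivity)
      (show (1 / 2 : ℝ) < 1 by norm_num)
    rw [lt_div_iff₀ (by positivity)] at hk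
    refine ⟨k, ?_⟩
    rintro ⟨c, hc⟩
    have h1 : N c ((1 / 2) ^ k * ρ₀) ≤ 1 := by
      refine Finset.card_le_one.2 fun v hv w hw => ?_
      by_contra hvw
      obtain ⟨hvA, hv⟩ := Finset.mem_filter.1 hv
      obtain ⟨hwA, hw⟩ := Finset.mem_filter.1 hw
      have h2 := dist_triangle_right (p v) (p w) c
      rw [Metric.mem_closedBall] at hv hw
      linarith [hsep v hvA w hwA hvw]
    have := Nat.mul_le_mul_left (2 * T.card) h1
    omega
  have hfind := Nat.find_spec hsmall
  have hmin := fun j => Nat.find_min hsmall (m := j)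
  generalize Nat.find hsmall = k at hfind hmin
  obtain _ | k := k
  · refine absurd ⟨0, ?_⟩ hfind
    have : N 0 ((1 / 2) ^ 0 * ρ₀) = A.card := by
      refine congrArg Finset.card (Finset.filter_true_of_mem fun v hv => ?_)
      simpa using hall v hv
    rw [this]
    nlinarith
  obtain ⟨c, hc⟩ := not_not.1 (hmin k (Nat.lt_succ_self k))
  have hR : 0 < (1 / 2) ^ k * ρ₀ := by positivity
  have hhalf : (1 / 2) ^ (k + 1) * ρ₀ = (1 / 2) ^ k * ρ₀ / 2 := by ring
  rw [hhalf] at hfind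
  push Not at hfind
  generalize (1 / 2) ^ k * ρ₀ = R at hc hR hfind
  refine ⟨c, R, hR, hc, ?_⟩
  have hcov : (A.filter fun v => p v ∈ Metric.closedBall c (2 * R)) ⊆
      T.biUnion fun x => A.filter fun v => p v ∈ Metric.closedBall (c + (R / 2) • x) (R / 2) := by
    intro v hv
    obtain ⟨hvA, hv⟩ := Finset.mem_filter.1 hv
    rw [mem_closedBall_iff_norm] at hv
    have h1 : (2 / R) • (p v - c) ∈ Metric.closedBall (0 : E) 4 := by
      rw [mem_closedBall_zero_iff, norm_smul, Real.norm_eq_abs, abs_of_pos (by positivity),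
        div_mul_eq_mul_div, div_le_iff₀ hR]
      linarith
    obtain ⟨x, hx, hvx⟩ := Set.mem_iUnion₂.1 (hT h1)
    refine Finset.mem_biUnion.2 ⟨x, hx, Finset.mem_filter.2 ⟨hvA, ?_⟩⟩
    rw [mem_closedBall_iff_norm] at hvx ⊢
    have h2 : p v - (c + (R / 2) • x) = (R / 2) • ((2 / R) • (p v - c) - x) := by
      rw [smul_sub, smul_smul, show R / 2 * (2 / R) = 1 by field_simp, one_smul]
      abel
    rw [h2, norm_smul, Real.norm_eq_abs, abs_of_pos (by positivity)]
    nlinarith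
  have h3 := (Finset.card_le_card hcov).trans Finset.card_biUnion_le
  have h4 : T.card * (2 * ∑ x ∈ T, N (c + (R / 2) • x) (R / 2)) ≤ T.card * A.card := by
    calc _ = ∑ x ∈ T, 2 * T.card * N (c + (R / 2) • x) (R / 2) := by
          rw [← Finset.mul_sum]; ring
      _ ≤ ∑ x ∈ T, A.card := Finset.sum_le_sum fun x _ => (hfind _).le
      _ = _ := by rw [Finset.sum_const, smul_eq_mul]
  have h5 := Nat.le_of_mul_le_mul_left h4 hT0
  exact (Nat.mul_le_mul_left 2 h3).trans h5

end Window

/-- Distinct representatives for finitely many infinite sets. -/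
theorem exists_injective_mem_of_infinite {V E : Type*} [Finite V] (S : V → Set E)
    (hS : ∀ v, (S v).Infinite) : ∃ p : V → E, Function.Injective p ∧ ∀ v, p v ∈ S v := by
  classical
  have := Fintype.ofFinite V
  choose t htS htc using fun v => (hS v).exists_subset_card_eq (Fintype.card V)
  obtain ⟨p, hp, hpt⟩ := (Finset.all_card_le_biUnion_card_iff_exists_injective t).1 fun s => by
    obtain rfl | ⟨v, hv⟩ := s.eq_empty_or_nonempty
    · simp
    · calc s.card ≤ (t v).card := by rw [htc]; exact s.card_le_univ
        _ ≤ _ := Finset.card_le_card (Finset.subset_biUnion_of_mem t hv)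
  exact ⟨p, hp, fun v => htS v (hpt v)⟩

/-! ### Enclosing sides and random collapses -/

section Enclosers

variable {V X : Type*} [Fintype V] [DecidableEq V] [TopologicalSpace X]

open Classical in
/-- The indices `u` whose side contains the side of `v` together with its boundary. -/
noncomputable def enclosers (E : V → Set X) (v : V) : Finset V :=
  Finset.univ.filter fun u => closure (E v) ⊆ E u

/-- The probability with which `v` is put in the random set. It is `0` for an isolated vertex,
because of `0⁻¹ = 0`. -/
noncomputable def samplingProb (G : SimpleGraph V) [DecidableRel G.Adj] (v : V) : ℝ :=
  (2 * (G.degree v : ℝ))⁻¹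

/-- The probability that no encloser of `v` is in the random set. -/
noncomputable def exposureProb (G : SimpleGraph V) [DecidableRel G.Adj] (E : V → Set X) (v : V) :
    ℝ :=
  ∏ u ∈ enclosers E v, (1 - samplingProb G u)

omit [DecidableEq V] in
theorem mem_enclosers {E : V → Set X} {u v : V} : u ∈ enclosers E v ↔ closure (E v) ⊆ E u := by
  simp [enclosers]

variable (G : SimpleGraph V) [DecidableRel G.Adj]

omit [DecidableEq V] in
theorem samplingProb_nonneg (v : V) : 0 ≤ samplingProb G v := by
  unfold samplingProb; positivity

omit [DecidableEq V] in
theorem samplingProb_le_one (v : V) : samplingProb G v ≤ 1 := by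
  unfold samplingProb
  rcases Nat.eq_zero_or_pos (G.degree v) with h | h
  · simp [h]
  · have : (1 : ℝ) ≤ G.degree v := by exact_mod_cast h
    exact inv_le_one_of_one_le₀ (by linarith)

omit [DecidableEq V] in
theorem exposureProb_nonneg (E : V → Set X) (v : V) : 0 ≤ exposureProb G E v :=
  Finset.prod_nonneg fun u _ => sub_nonneg.2 (samplingProb_le_one G u)

omit [DecidableEq V] in
theorem exposureProb_le_one (E : V → Set X) (v : V) : exposureProb G E v ≤ 1 :=
  Finset.prod_le_one (fun u _ => sub_nonneg.2 (samplingProb_le_one G u))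
    fun u _ => by linarith [samplingProb_nonneg G u]

variable {S E F : V → Set X} (hside : ∀ v, IsSidePair (S v) (E v) (F v))

include hside in
omit [Fintype V] [DecidableEq V] in
theorem disjoint_of_closure_subset {u v : V} (h : closure (E v) ⊆ E u) :
    Disjoint (S v) (S u) :=
  (Set.disjoint_of_subset_right ((hside v).subset_closure_left.trans h)
    (hside u).disjoint_left).symm

include hside in
omit [DecidableEq V] in
theorem notMem_enclosers_self (v : V) : v ∉ enclosers E v := by
  rw [mem_enclosers]
  intro h
  obtain ⟨x, hx⟩ := (hside v).nonempty
  exact Set.disjoint_left.1 (disjoint_of_closure_subset hside h) hx hx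

open Classical in
include hside in
/-- **Local density of the exposed vertices.** A sampled vertex `v` is kept if it is exposed and no
neighbour of at least the same degree is sampled. Kept vertices are pairwise non-adjacent, and
non-adjacent hypersurfaces whose sides contain `x` have nested sides, so at most one kept vertex has
`x` in its side. As the enclosers of `v` are not neighbours of `v`, the conditions are independent,
and `v` is kept with probability at least `samplingProb G v * exposureProb G E v / 2`. -/
theorem sum_samplingProb_mul_exposureProb_le
    (hG : ∀ u v, u ≠ v → ¬ G.Adj u v → Disjoint (S u) (S v))
    (hG' : ∀ u v, G.Adj u v → ¬ Disjoint (S u) (S v)) (hcov : ∀ u v, E u ∪ E v ≠ Set.univ) (x : X) :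
    ∑ v, (if x ∈ E v then samplingProb G v * exposureProb G E v else 0) ≤ 2 := by
  let q := samplingProb G
  let B : V → Finset V := fun v => (G.neighborFinset v).filter fun w => G.degree v ≤ G.degree w
  let kept : Finset V → V → Prop := fun D v => {v} ⊆ D ∧ Disjoint D (enclosers E v ∪ B v)
  have hB : ∀ v, 1 / 2 ≤ ∏ w ∈ B v, (1 - q w) := by
    intro v
    refine le_trans ?_ (one_sub_sum_le_prod_one_sub (samplingProb_nonneg G)
      (samplingProb_le_one G) (B v))
    have h1 : ∑ w ∈ B v, q w ≤ (B v).card • (2 * (G.degree v : ℝ))⁻¹ := by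
      refine Finset.sum_le_card_nsmul _ _ _ fun w hw => ?_
      obtain ⟨hvw, hd⟩ := Finset.mem_filter.1 hw
      have h0 : 0 < G.degree v := by
        rw [← G.card_neighborFinset_eq_degree]
        exact Finset.card_pos.2 ⟨w, hvw⟩
      have h0' : (0 : ℝ) < G.degree v := by exact_mod_cast h0
      have hd' : (G.degree v : ℝ) ≤ G.degree w := by exact_mod_cast hd
      exact inv_anti₀ (by linarith) (by linarith)
    have h2 : (B v).card ≤ G.degree v := by
      rw [← G.card_neighborFinset_eq_degree]
      exact Finset.card_filter_le _ _
    have h3 : (B v).card • (2 * (G.degree v : ℝ))⁻¹ ≤ 1 / 2 := by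
      rw [nsmul_eq_mul]
      rcases Nat.eq_zero_or_pos (G.degree v) with h | h
      · rw [h]; norm_num
      · have h' : (0 : ℝ) < G.degree v := by exact_mod_cast h
        have h2' : ((B v).card : ℝ) ≤ G.degree v := by exact_mod_cast h2
        rw [← div_eq_mul_inv, div_le_iff₀ (by positivity)]
        linarith
    linarith
  have hprob : ∀ v, q v * exposureProb G E v ≤
      2 * ∑ D, (if kept D v then bernoulliWeight q D else 0) := by
    intro v
    have hBv : v ∉ B v := fun h => by simpa using (Finset.mem_filter.1 h).1
    have hd : Disjoint {v} (enclosers E v ∪ B v) :=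
      Finset.disjoint_singleton_left.2 fun h => (Finset.mem_union.1 h).elim
        (notMem_enclosers_self hside v) hBv
    have hdd : Disjoint (enclosers E v) (B v) := Finset.disjoint_left.2 fun u hu huB =>
      hG' v u (by simpa using (Finset.mem_filter.1 huB).1)
        (disjoint_of_closure_subset hside (mem_enclosers.1 hu))
    rw [sum_bernoulliWeight_subset_disjoint q hd, Finset.prod_union hdd, Finset.prod_singleton]
    have h1 : 0 ≤ q v * exposureProb G E v :=
      mul_nonneg (samplingProb_nonneg G v) (exposureProb_nonneg G E v)
    calc q v * exposureProb G E v ≤ 2 * ((q v * exposureProb G E v) * ∏ w ∈ B v, (1 - q w)) := by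
          nlinarith [hB v]
      _ = _ := by rw [exposureProb]; ring
  have hone : ∀ D, ∑ v, (if x ∈ E v ∧ kept D v then (1 : ℝ) else 0) ≤ 1 := by
    intro D
    rw [Finset.sum_boole]
    have : (Finset.univ.filter fun v => x ∈ E v ∧ kept D v).card ≤ 1 := by
      refine Finset.card_le_one.2 fun u hu v hv => ?_
      by_contra huv
      obtain ⟨-, hxu, huD, hu⟩ := Finset.mem_filter.1 hu
      obtain ⟨-, hxv, hvD, hv⟩ := Finset.mem_filter.1 hv
      rw [Finset.singleton_subset_iff] at huD hvD
      rw [Finset.disjoint_union_right] at hu hv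
      have hadj : ¬ G.Adj u v := by
        intro hadj
        rcases le_total (G.degree u) (G.degree v) with h | h
        · exact Finset.disjoint_left.1 hu.2 hvD
            (Finset.mem_filter.2 ⟨by simpa using hadj, h⟩)
        · exact Finset.disjoint_left.1 hv.2 huD
            (Finset.mem_filter.2 ⟨by simpa using hadj.symm, h⟩)
      rcases (hside u).trichotomy (hside v) (hG u v huv hadj) hxu hxv with h | h | h
      · exact Finset.disjoint_left.1 hu.1 hvD (mem_enclosers.2 h)
      · exact Finset.disjoint_left.1 hv.1 huD (mem_enclosers.2 h)
      · exact hcov u v h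
    exact_mod_cast this
  calc ∑ v, (if x ∈ E v then q v * exposureProb G E v else 0)
      ≤ ∑ v, (if x ∈ E v then 2 * ∑ D, (if kept D v then bernoulliWeight q D else 0) else 0) := by
        refine Finset.sum_le_sum fun v _ => ?_
        split_ifs
        · exact hprob v
        · exact le_rfl
    _ = 2 * ∑ D, bernoulliWeight q D * ∑ v, (if x ∈ E v ∧ kept D v then (1 : ℝ) else 0) := by
        simp_rw [Finset.mul_sum]
        rw [Finset.sum_comm]
        refine Finset.sum_congr rfl fun v _ => ?_
        by_cases hx : x ∈ E v
        · simp only [hx, if_true, true_and]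
          exact Finset.sum_congr rfl fun D _ => by split_ifs <;> simp
        · simp [hx]
    _ ≤ 2 * ∑ D, bernoulliWeight q D * 1 := by
        refine mul_le_mul_of_nonneg_left (Finset.sum_le_sum fun D _ => ?_) zero_le_two
        exact mul_le_mul_of_nonneg_left (hone D) (bernoulliWeight_nonneg (samplingProb_nonneg G)
          (samplingProb_le_one G) D)
    _ = 2 := by simp [sum_bernoulliWeight]

open Classical in
/-- The vertices removed for a sample `D` and a set `M` of vertices: the exposed non-isolated ones
in `M`, and the neighbours of the exposed sampled ones in `M`. -/
noncomputable def removedVertices (E : V → Set X) (D M : Finset V) : Finset V :=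
  (M.filter fun v => 0 < G.degree v ∧ Disjoint D (enclosers E v)) ∪
    (M.filter fun u => u ∈ D ∧ Disjoint D (enclosers E u)).biUnion fun u => G.neighborFinset u

open Classical in
include hside in
/-- On average, removing the neighbours of a vertex that is sampled and exposed costs no more than
removing the vertex when it is exposed, since the sampling probability is inverse to the degree. -/
theorem exists_card_removedVertices_le (M : Finset V) :
    ∃ D, ((removedVertices G E D M).card : ℝ) ≤
      2 * ∑ v ∈ M, (if 0 < G.degree v then exposureProb G E v else 0) := by
  let q := samplingProb G
  refine exists_le_of_sum_bernoulliWeight_mul_le (samplingProb_nonneg G) (samplingProb_le_one G)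
    (fun D => ((removedVertices G E D M).card : ℝ)) ?_
  have hcard : ∀ D, ((removedVertices G E D M).card : ℝ) ≤
      ∑ v ∈ M, ((if 0 < G.degree v ∧ Disjoint D (enclosers E v) then 1 else 0) +
        (if v ∈ D ∧ Disjoint D (enclosers E v) then (G.degree v : ℝ) else 0)) := by
    intro D
    rw [Finset.sum_add_distrib, Finset.sum_boole, ← Finset.sum_filter]
    have h1 := (Finset.card_union_le (M.filter fun v => 0 < G.degree v ∧ Disjoint D (enclosers E v))
      ((M.filter fun u => u ∈ D ∧ Disjoint D (enclosers E u)).biUnion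
        fun u => G.neighborFinset u)).trans (Nat.add_le_add_left Finset.card_biUnion_le _)
    simp only [G.card_neighborFinset_eq_degree] at h1
    exact_mod_cast h1
  calc ∑ D, bernoulliWeight q D * ((removedVertices G E D M).card : ℝ)
      ≤ ∑ D, bernoulliWeight q D *
        ∑ v ∈ M, ((if 0 < G.degree v ∧ Disjoint D (enclosers E v) then 1 else 0) +
          (if v ∈ D ∧ Disjoint D (enclosers E v) then (G.degree v : ℝ) else 0)) :=
        Finset.sum_le_sum fun D _ => mul_le_mul_of_nonneg_left (hcard D)
          (bernoulliWeight_nonneg (samplingProb_nonneg G) (samplingProb_le_one G) D)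
    _ = ∑ v ∈ M, ((if 0 < G.degree v then
          ∑ D, (if ∅ ⊆ D ∧ Disjoint D (enclosers E v) then bernoulliWeight q D else 0) else 0) +
          G.degree v *
            ∑ D, (if {v} ⊆ D ∧ Disjoint D (enclosers E v) then bernoulliWeight q D else 0)) := by
        simp_rw [Finset.mul_sum]
        rw [Finset.sum_comm]
        refine Finset.sum_congr rfl fun v _ => ?_
        simp only [Finset.empty_subset, true_and, Finset.singleton_subset_iff]
        by_cases h0 : 0 < G.degree v
        · rw [if_pos h0, ← Finset.sum_add_distrib]
          refine Finset.sum_congr rfl fun D _ => ?_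
          by_cases h1 : Disjoint D (enclosers E v) <;> by_cases h2 : v ∈ D <;>
            simp [h0, h1, h2]
          ring
        · simp [Nat.eq_zero_of_not_pos h0]
    _ = ∑ v ∈ M, ((if 0 < G.degree v then exposureProb G E v else 0) +
          G.degree v * (q v * exposureProb G E v)) := by
        refine Finset.sum_congr rfl fun v _ => ?_
        rw [sum_bernoulliWeight_subset_disjoint q (Finset.disjoint_empty_left _),
          sum_bernoulliWeight_subset_disjoint q
            (Finset.disjoint_singleton_left.2 (notMem_enclosers_self hside v))]
        simp [exposureProb, q]
    _ ≤ 2 * ∑ v ∈ M, (if 0 < G.degree v then exposureProb G E v else 0) := by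
        rw [Finset.mul_sum]
        refine Finset.sum_le_sum fun v _ => ?_
        split_ifs with h
        · have h' : (0 : ℝ) < G.degree v := by exact_mod_cast h
          have : (G.degree v : ℝ) * (q v * exposureProb G E v) = 1 / 2 * exposureProb G E v := by
            simp only [q, samplingProb]
            field_simp
          rw [this]
          linarith [exposureProb_nonneg G E v]
        · simp [Nat.eq_zero_of_not_pos h]

end Enclosers

/-! ### Averaging over the radius, volume and Hölder's inequality -/

open MeasureTheory in
/-- First moment method for weighted intervals of lengths `2 s v`. -/
theorem exists_sum_indicator_Icc_le {V : Type*} [Fintype V] (w a s : V → ℝ) (hw : ∀ v, 0 ≤ w v)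
    (hs : ∀ v, 0 ≤ s v) {R : ℝ} (hR : 0 < R) :
    ∃ t ∈ Set.Icc R (2 * R),
      ∑ v, (Set.Icc (a v) (a v + 2 * s v)).indicator (fun _ => w v) t ≤
        2 * ∑ v, w v * (s v / R) := by
  have hvol : volume (Set.Icc R (2 * R)) = ENNReal.ofReal R := by
    rw [Real.volume_Icc]; congr 1; ring
  have hint : ∀ v, IntegrableOn ((Set.Icc (a v) (a v + 2 * s v)).indicator fun _ => w v)
      (Set.Icc R (2 * R)) volume := fun v =>
    (integrableOn_const (by simp [hvol])).indicator measurableSet_Icc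
  obtain ⟨t, ht, h⟩ := exists_le_setAverage (μ := volume) (s := Set.Icc R (2 * R))
    (f := fun t => ∑ v, (Set.Icc (a v) (a v + 2 * s v)).indicator (fun _ => w v) t)
    (by simp [hvol, hR]) (by simp [hvol]) (integrable_finsetSum _ fun v _ => hint v)
  refine ⟨t, ht, h.trans ?_⟩
  rw [setAverage_eq, integral_finsetSum _ fun v _ => hint v, measureReal_def, hvol,
    ENNReal.toReal_ofReal hR.le, smul_eq_mul, Finset.mul_sum, Finset.mul_sum]
  refine Finset.sum_le_sum fun v _ => ?_
  have h1 : ∫ t in Set.Icc R (2 * R), (Set.Icc (a v) (a v + 2 * s v)).indicator (fun _ => w v) t ≤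
      2 * s v * w v := by
    rw [integral_indicator measurableSet_Icc, setIntegral_const, smul_eq_mul]
    refine mul_le_mul_of_nonneg_right ?_ (hw v)
    have h2 : (volume.restrict (Set.Icc R (2 * R))).real (Set.Icc (a v) (a v + 2 * s v)) ≤
        volume.real (Set.Icc (a v) (a v + 2 * s v)) :=
      ENNReal.toReal_mono measure_Icc_lt_top.ne (Measure.restrict_apply_le _ _)
    refine h2.trans ?_
    rw [Real.volume_real_Icc]
    exact max_le (by linarith) (by linarith [hs v])
  calc R⁻¹ * _ ≤ R⁻¹ * (2 * s v * w v) := mul_le_mul_of_nonneg_left h1 (by positivity)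
    _ = _ := by ring

open MeasureTheory Classical in
/-- Sets in which a weighted family covers every point at most twice, and which contain balls in a
common ball, satisfy a volume bound. -/
theorem sum_mul_pow_le_of_ball_subset {V X : Type*} [Fintype V] [NormedAddCommGroup X]
    [NormedSpace ℝ X] [FiniteDimensional ℝ X] [Nontrivial X] (g s : V → ℝ) (hg : ∀ v, 0 ≤ g v)
    (hs : ∀ v, 0 ≤ s v) (E : V → Set X) (hE : ∀ x, ∑ v, (if x ∈ E v then g v else 0) ≤ 2)
    (c : X) {R : ℝ} (hR : 0 < R) (y : V → X)
    (hy : ∀ v, Metric.ball (y v) (s v) ⊆ E v ∩ Metric.ball c (4 * R)) :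
    ∑ v, g v * (s v / R) ^ Module.finrank ℝ X ≤ 2 * 4 ^ Module.finrank ℝ X := by
  borelize X
  let μ : Measure X := Measure.addHaar
  let m := Module.finrank ℝ X
  have hball : ∀ (x : X) {r : ℝ}, 0 ≤ r →
      μ.real (Metric.ball x r) = r ^ m * μ.real (Metric.ball 0 1) := by
    intro x r hr
    rw [measureReal_def, Measure.addHaar_ball μ x hr, ENNReal.toReal_mul,
      ENNReal.toReal_ofReal (by positivity), measureReal_def]
  have hω : 0 < μ.real (Metric.ball (0 : X) 1) :=
    ENNReal.toReal_pos (Metric.measure_ball_pos μ 0 one_pos).ne' measure_ball_lt_top.ne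
  have hint : ∀ v, IntegrableOn ((Metric.ball (y v) (s v)).indicator fun _ => g v)
      (Metric.ball c (4 * R)) μ := fun v =>
    (integrableOn_const measure_ball_lt_top.ne).indicator measurableSet_ball
  have h1 : ∫ x in Metric.ball c (4 * R),
      ∑ v, (Metric.ball (y v) (s v)).indicator (fun _ => g v) x ∂μ ≤
        ∫ _ in Metric.ball c (4 * R), (2 : ℝ) ∂μ := by
    refine setIntegral_mono (integrable_finsetSum _ fun v _ => hint v)
      (integrableOn_const measure_ball_lt_top.ne) fun x => ?_
    refine le_trans (Finset.sum_le_sum fun v _ => ?_) (hE x)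
    by_cases hx : x ∈ Metric.ball (y v) (s v)
    · rw [Set.indicator_of_mem hx, if_pos (hy v hx).1]
    · rw [Set.indicator_of_notMem hx]
      split_ifs
      exacts [hg v, le_rfl]
  rw [integral_finsetSum _ fun v _ => hint v, setIntegral_const, hball c (by positivity),
    smul_eq_mul] at h1
  have h2 : ∀ v, ∫ x in Metric.ball c (4 * R), (Metric.ball (y v) (s v)).indicator
      (fun _ => g v) x ∂μ = g v * (s v / R) ^ m * (R ^ m * μ.real (Metric.ball 0 1)) := by
    intro v
    rw [integral_indicator measurableSet_ball, setIntegral_const, smul_eq_mul, measureReal_def,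
      Measure.restrict_apply measurableSet_ball,
      Set.inter_eq_left.2 ((hy v).trans Set.inter_subset_right), ← measureReal_def,
      hball _ (hs v), div_pow]
    field_simp
  simp_rw [h2] at h1
  rw [← Finset.sum_mul] at h1
  have h3 : (4 * R) ^ m * μ.real (Metric.ball (0 : X) 1) * 2 =
      2 * 4 ^ m * (R ^ m * μ.real (Metric.ball 0 1)) := by ring
  rw [h3] at h1
  exact le_of_mul_le_mul_right h1 (by positivity)

/-- Hölder's inequality with weights `P v * (2 * δ v) ^ (1 / (d - 1))`. -/
theorem sum_mul_le_rpow_mul_rpow {V : Type*} (A : Finset V) {d : ℕ} (hd : 2 ≤ d) (P δ x : V → ℝ)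
    (hP0 : ∀ v, 0 ≤ P v) (hP1 : ∀ v, P v ≤ 1) (hδ : ∀ v ∈ A, 0 < δ v) (hx : ∀ v, 0 ≤ x v)
    (hδ0 : ∀ v, 0 ≤ δ v) {B : ℝ} (hB : ∑ v ∈ A, (2 * δ v)⁻¹ * P v * x v ^ d ≤ B) :
    ∑ v ∈ A, P v * x v ≤
      (2 * ∑ v ∈ A, δ v ^ (1 / ((d : ℝ) - 1))) ^ (1 - 1 / (d : ℝ)) * B ^ (1 / (d : ℝ)) := by
  have hd' : (2 : ℝ) ≤ d := by exact_mod_cast hd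
  let e : ℝ := 1 / ((d : ℝ) - 1)
  have he : 0 < e := one_div_pos.2 (by linarith)
  have he1 : e ≤ 1 := (div_le_one (by linarith)).2 (by linarith)
  have hed : e * d = e + 1 := by
    have : (d : ℝ) - 1 ≠ 0 := by linarith
    simp only [e]; field_simp; ring
  have hpow : ∀ v, 0 ≤ (2 * δ v) ^ e := fun v => Real.rpow_nonneg (by linarith [hδ0 v]) _
  have hq : ∀ v, 0 ≤ (2 * δ v) ^ (-e) := fun v => Real.rpow_nonneg (by linarith [hδ0 v]) _
  have h := Real.inner_le_weight_mul_Lp_of_nonneg A (p := d) (by linarith)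
    (fun v => P v * (2 * δ v) ^ e) (fun v => (2 * δ v) ^ (-e) * x v)
    (fun v => mul_nonneg (hP0 v) (hpow v)) (fun v => mul_nonneg (hq v) (hx v))
  have h1 : ∀ v ∈ A, P v * (2 * δ v) ^ e * ((2 * δ v) ^ (-e) * x v) = P v * x v := by
    intro v hv
    have h2 : 0 < 2 * δ v := by linarith [hδ v hv]
    rw [Real.rpow_neg h2.le]
    have := (Real.rpow_pos_of_pos h2 e).ne'
    field_simp
  have h2 : ∀ v ∈ A, P v * (2 * δ v) ^ e * ((2 * δ v) ^ (-e) * x v) ^ (d : ℝ) =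
      (2 * δ v)⁻¹ * P v * x v ^ d := by
    intro v hv
    have h2 : 0 < 2 * δ v := by linarith [hδ v hv]
    rw [Real.mul_rpow (hq v) (hx v), ← Real.rpow_mul h2.le, Real.rpow_natCast]
    have h3 : (2 * δ v) ^ e * (2 * δ v) ^ (-e * d) = (2 * δ v)⁻¹ := by
      rw [← Real.rpow_add h2, ← Real.rpow_neg_one]
      congr 1
      linarith
    rw [← h3]; ring
  rw [Finset.sum_congr rfl h1, Finset.sum_congr rfl h2] at h
  rw [one_div (d : ℝ)]
  refine h.trans (mul_le_mul ?_ ?_ ?_ ?_)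
  · refine Real.rpow_le_rpow (Finset.sum_nonneg fun v _ => mul_nonneg (hP0 v) (hpow v)) ?_ ?_
    · rw [Finset.mul_sum]
      refine Finset.sum_le_sum fun v _ => ?_
      have h4 : (2 : ℝ) ^ e ≤ 2 := by
        simpa using Real.rpow_le_rpow_of_exponent_le (x := 2) (by norm_num) he1
      calc P v * (2 * δ v) ^ e ≤ 1 * (2 * δ v) ^ e := mul_le_mul_of_nonneg_right (hP1 v) (hpow v)
        _ = 2 ^ e * δ v ^ e := by rw [one_mul, Real.mul_rpow (by norm_num) (hδ0 v)]
        _ ≤ 2 * δ v ^ e := mul_le_mul_of_nonneg_right h4 (Real.rpow_nonneg (hδ0 v) _)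
    · rw [sub_nonneg]; exact inv_le_one_of_one_le₀ (by linarith)
  · refine Real.rpow_le_rpow (Finset.sum_nonneg fun v hv => ?_) hB (by positivity)
    have := hδ0 v; have := hP0 v; have := hx v
    positivity
  · refine Real.rpow_nonneg (Finset.sum_nonneg fun v hv => ?_) _
    have := hδ0 v; have := hP0 v; have := hx v
    positivity
  · exact Real.rpow_nonneg (mul_nonneg zero_le_two
      (Finset.sum_nonneg fun v _ => Real.rpow_nonneg (hδ0 v) _)) _

/-! ### Separators of proportional size -/

/-- `Y` induces a connected subgraph of `G` or is empty: a property that passes along the edges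
inside `Y` and holds somewhere in `Y` holds everywhere in `Y`. -/
def IsConnectedSet {V : Type*} (G : SimpleGraph V) (Y : Finset V) : Prop :=
  ∀ P : V → Prop, (∀ a ∈ Y, ∀ b ∈ Y, G.Adj a b → P a → P b) → (∃ a ∈ Y, P a) → ∀ b ∈ Y, P b

theorem IsConnectedSet.eq_of_degree_eq_zero {V : Type*} [Fintype V] {G : SimpleGraph V}
    [DecidableRel G.Adj] {Y : Finset V} (hY : IsConnectedSet G Y) {w : V} (hw : w ∈ Y)
    (h0 : G.degree w = 0) : ∀ v ∈ Y, v = w := by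
  refine hY (fun v => v = w) (fun a _ b _ hab ha => ?_) ⟨w, hw, rfl⟩
  subst ha
  have := (G.degree_pos_iff_exists_adj a).2 ⟨b, hab⟩
  omega

section Structure

variable {V X : Type*} [Fintype V] [DecidableEq V] [TopologicalSpace X]

open Classical in
/-- A connected set of vertices that avoids `removedVertices` is a single vertex, is confined to
one side of a sampled hypersurface, or misses the cutting set `Q`. -/
theorem IsConnectedSet.confined_of_disjoint_removedVertices {G : SimpleGraph V}
    [DecidableRel G.Adj] {S E F : V → Set X} (hside : ∀ v, IsSidePair (S v) (E v) (F v))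
    (hG : ∀ u v, u ≠ v → ¬ G.Adj u v → Disjoint (S u) (S v))
    (hG' : ∀ u v, G.Adj u v → ¬ Disjoint (S u) (S v)) (Q : Set X) (D Y : Finset V)
    (hY : IsConnectedSet G Y)
    (hYD : Disjoint Y (removedVertices G E D
      (Finset.univ.filter fun v => (closure (E v) ∩ Q).Nonempty))) :
    Y.card ≤ 1 ∨ (∃ u, ∀ w ∈ Y, S w ⊆ E u) ∨ ∀ w ∈ Y, Disjoint (S w) Q := by
  by_cases hQ : ∀ w ∈ Y, Disjoint (S w) Q
  · exact Or.inr (Or.inr hQ)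
  push Not at hQ
  obtain ⟨w, hwY, hwQ⟩ := hQ
  obtain ⟨x, hxw, hxQ⟩ := Set.not_disjoint_iff.1 hwQ
  rcases Nat.eq_zero_or_pos (G.degree w) with h0 | h0
  · refine Or.inl (Finset.card_le_one.2 fun a ha b hb => ?_)
    rw [hY.eq_of_degree_eq_zero hwY h0 a ha, hY.eq_of_degree_eq_zero hwY h0 b hb]
  have hwE : x ∈ closure (E w) := (hside w).subset_closure_left hxw
  have hwD : ¬ Disjoint D (enclosers E w) := by
    intro h
    refine Finset.disjoint_left.1 hYD hwY (Finset.mem_union_left _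
      (Finset.mem_filter.2 ⟨?_, h0, h⟩))
    exact Finset.mem_filter.2 ⟨Finset.mem_univ _, x, hwE, hxQ⟩
  obtain ⟨u₀, hu₀⟩ := Finset.not_disjoint_iff.1 hwD
  -- an outermost sampled encloser of `w`
  obtain ⟨u, hu, hmin⟩ := (D ∩ enclosers E w).exists_min_image (fun u => (enclosers E u).card)
    ⟨u₀, Finset.mem_inter.2 hu₀⟩
  obtain ⟨huD, huw⟩ := Finset.mem_inter.1 hu
  rw [mem_enclosers] at huw
  have hexp : Disjoint D (enclosers E u) := by
    refine Finset.disjoint_left.2 fun u' hu'D hu' => ?_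
    rw [mem_enclosers] at hu'
    have hlt : enclosers E u' ⊂ enclosers E u := by
      refine Finset.ssubset_iff_subset_ne.2 ⟨fun y hy => ?_, fun h => ?_⟩
      · rw [mem_enclosers] at hy ⊢
        exact hu'.trans (subset_closure.trans hy)
      · exact notMem_enclosers_self hside u' (h ▸ mem_enclosers.2 hu')
    refine (Finset.card_lt_card hlt).not_ge (hmin u' (Finset.mem_inter.2 ⟨hu'D, ?_⟩))
    exact mem_enclosers.2 (huw.trans (subset_closure.trans hu'))
  have hnb : ∀ b ∈ Y, ¬ G.Adj u b := by
    intro b hb hub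
    refine Finset.disjoint_left.1 hYD hb (Finset.mem_union_right _ (Finset.mem_biUnion.2
      ⟨u, Finset.mem_filter.2 ⟨Finset.mem_filter.2 ⟨Finset.mem_univ _, x, ?_, hxQ⟩, huD, hexp⟩,
        by simpa using hub⟩))
    exact subset_closure (huw hwE)
  refine Or.inr (Or.inl ⟨u, hY (fun v => S v ⊆ E u) (fun a _ b hb hab ha => ?_)
    ⟨w, hwY, (hside w).subset_closure_left.trans huw⟩⟩)
  have hdis : Disjoint (S a) (S u) := (Set.disjoint_of_subset_right ha (hside u).disjoint_left).symm
  obtain ⟨z, hza, hzb⟩ := Set.not_disjoint_iff.1 (hG' a b hab)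
  have hub : u ≠ b := by
    rintro rfl
    exact hG' a u hab hdis
  exact (hside u).subset_left (hside b).isPreconnected (hG u b hub (hnb b hb)).symm hzb (ha hza)

end Structure

open Classical in
/-- Of the two sides of a sphere, choose the interior if it holds at most half of the points and the
exterior otherwise. Two of the chosen sides never cover the space. -/
theorem exists_sides {X : Type*} [NormedAddCommGroup X] [NormedSpace ℝ X]
    (hX : 1 < Module.rank ℝ X) {V : Type*} (S : V → EuclideanGeometry.Sphere X)
    (hr : ∀ v, 0 < (S v).radius) (A : Finset V) (p : V → X) :
    ∃ E F : V → Set X,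
      (∀ v, IsSidePair (Metric.sphere (S v).center (S v).radius) (E v) (F v)) ∧
      (∀ v, 2 * (A.filter fun w => p w ∈ E v).card ≤ A.card) ∧
      (∀ u v, E u ∪ E v ≠ Set.univ) ∧
      ∀ v, E v = Metric.ball (S v).center (S v).radius ∨
        E v = (Metric.closedBall (S v).center (S v).radius)ᶜ := by
  let N : Set X → ℕ := fun U => (A.filter fun w => p w ∈ U).card
  have hdisj : ∀ U W : Set X, Disjoint U W → N U + N W ≤ A.card := by
    intro U W h
    rw [← Finset.card_union_of_disjoint
      (Finset.disjoint_filter.2 fun w _ h1 h2 => Set.disjoint_left.1 h h1 h2)]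
    exact Finset.card_le_card
      (Finset.union_subset (Finset.filter_subset _ _) (Finset.filter_subset _ _))
  have hcover : ∀ U W : Set X, U ∪ W = Set.univ → A.card ≤ N U + N W := by
    intro U W h
    refine le_trans (Finset.card_le_card fun w hw => ?_) (Finset.card_union_le _ _)
    have : p w ∈ U ∪ W := h ▸ Set.mem_univ _
    simpa [hw] using this
  have key : ∀ v, ∃ E F : Set X,
      IsSidePair (Metric.sphere (S v).center (S v).radius) E F ∧
      (2 * N E ≤ A.card ∧ E = Metric.ball (S v).center (S v).radius ∨
        2 * N E < A.card ∧ E = (Metric.closedBall (S v).center (S v).radius)ᶜ) := by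
    intro v
    have hs := isSidePair_sphere hX (S v).center (hr v)
    have := hdisj _ _ hs.disjoint_sides
    by_cases h : 2 * N (Metric.ball (S v).center (S v).radius) ≤ A.card
    · exact ⟨_, _, hs, Or.inl ⟨h, rfl⟩⟩
    · exact ⟨_, _, hs.symm, Or.inr ⟨by omega, rfl⟩⟩
  choose E F hEF hE using key
  refine ⟨E, F, hEF, fun v => (hE v).elim (fun h => h.1) fun h => h.1.le, fun u v huv => ?_,
    fun v => (hE v).imp And.right And.right⟩
  have hle := hcover _ _ huv
  have : Nontrivial X := rank_pos_iff_nontrivial.1 (zero_lt_one.trans hX)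
  rcases hE u with hu | hu <;> rcases hE v with hv | hv
  · rw [hu.2, hv.2] at huv
    exact NormedSpace.unbounded_univ ℝ X (huv ▸ Metric.isBounded_ball.union Metric.isBounded_ball)
  all_goals omega

theorem one_lt_rank_euclideanSpace {d : ℕ} (hd : 2 ≤ d) :
    1 < Module.rank ℝ (EuclideanSpace ℝ (Fin d)) := by
  rw [rank_eq_card_basis (EuclideanSpace.basisFun (Fin d) ℝ).toBasis, Fintype.card_fin]
  exact_mod_cast hd

theorem infinite_sphere {X : Type*} [NormedAddCommGroup X] [NormedSpace ℝ X]
    (hX : 1 < Module.rank ℝ X) (z : X) {r : ℝ} (hr : 0 < r) : (Metric.sphere z r).Infinite := by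
  have : Nontrivial X := rank_pos_iff_nontrivial.1 (zero_lt_one.trans hX)
  obtain ⟨e, he⟩ := exists_norm_eq X hr.le
  have h1 : z + e ∈ Metric.sphere z r := by simp [he]
  have h2 : z - e ∈ Metric.sphere z r := by simp [he]
  refine (isPreconnected_sphere hX z r).infinite_of_nontrivial ⟨_, h1, _, h2, fun h => ?_⟩
  have h3 : e = -e := by simpa [sub_eq_add_neg] using h
  have h4 : e = 0 := by
    have : (2 : ℝ) • e = 0 := by rw [two_smul, add_eq_zero_iff_eq_neg]; exact h3
    simpa using this
  rw [h4, norm_zero] at he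
  exact hr.ne he

theorem disjoint_sphere_of_not_adj {d : ℕ} {V : Type*}
    (S : V → EuclideanGeometry.Sphere (EuclideanSpace ℝ (Fin d))) (u v : V) (huv : u ≠ v)
    (h : ¬ (sphereGraph S).Adj u v) :
    Disjoint (Metric.sphere (S u).center (S u).radius)
      (Metric.sphere (S v).center (S v).radius) := by
  rw [Set.disjoint_iff_inter_eq_empty, ← Set.not_nonempty_iff_eq_empty]
  exact fun h' => h ⟨huv, h'⟩

theorem not_disjoint_sphere_of_adj {d : ℕ} {V : Type*}
    (S : V → EuclideanGeometry.Sphere (EuclideanSpace ℝ (Fin d))) (u v : V)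
    (h : (sphereGraph S).Adj u v) :
    ¬ Disjoint (Metric.sphere (S u).center (S u).radius)
      (Metric.sphere (S v).center (S v).radius) :=
  Set.not_disjoint_iff_nonempty_inter.2 h.2

/-- The sum of the `1 / (d - 1)`-th powers of the degrees of a sphere graph. -/
noncomputable def degreeSum {d n : ℕ}
    (S : Fin n → EuclideanGeometry.Sphere (EuclideanSpace ℝ (Fin d))) : ℝ :=
  ∑ i, ((sphereGraph S).degree i : ℝ) ^ (1 / ((d : ℝ) - 1))

theorem card_filter_degree_pos_le_degreeSum {d n : ℕ} (hd : 2 ≤ d)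
    (S : Fin n → EuclideanGeometry.Sphere (EuclideanSpace ℝ (Fin d))) (A : Finset (Fin n)) :
    ((A.filter fun v => 0 < (sphereGraph S).degree v).card : ℝ) ≤ degreeSum S := by
  have hd' : (2 : ℝ) ≤ d := by exact_mod_cast hd
  have h0 : ∀ v, 0 ≤ ((sphereGraph S).degree v : ℝ) ^ (1 / ((d : ℝ) - 1)) :=
    fun v => Real.rpow_nonneg (Nat.cast_nonneg _) _
  calc ((A.filter fun v => 0 < (sphereGraph S).degree v).card : ℝ)
      = ∑ v ∈ A.filter fun v => 0 < (sphereGraph S).degree v, (1 : ℝ) := by simp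
    _ ≤ ∑ v ∈ A.filter fun v => 0 < (sphereGraph S).degree v,
        ((sphereGraph S).degree v : ℝ) ^ (1 / ((d : ℝ) - 1)) := by
      refine Finset.sum_le_sum fun v hv => Real.one_le_rpow ?_ ?_
      · exact_mod_cast (Finset.mem_filter.1 hv).2
      · exact one_div_nonneg.2 (by linarith)
    _ ≤ degreeSum S :=
      Finset.sum_le_sum_of_subset_of_nonneg (Finset.subset_univ _) fun v _ _ => h0 v

/-- Few vertices are separated by removing the non-isolated ones among them. -/
theorem exists_separator_of_card_le {d n : ℕ} (hd : 2 ≤ d)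
    (S : Fin n → EuclideanGeometry.Sphere (EuclideanSpace ℝ (Fin d))) {k : ℕ} (hk : 0 < k)
    (A : Finset (Fin n)) (hAk : A.card ≤ k) :
    ∃ Z : Finset (Fin n), (Z.card : ℝ) ≤ k * degreeSum S ^ (1 - 1 / (d : ℝ)) ∧
      ∀ Y, IsConnectedSet (sphereGraph S) Y → Disjoint Y Z → (Y ∩ A).card ≤ 1 := by
  have hd' : (2 : ℝ) ≤ d := by exact_mod_cast hd
  refine ⟨A.filter fun v => 0 < (sphereGraph S).degree v, ?_, fun Y hY hYZ => ?_⟩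
  · have h1 := card_filter_degree_pos_le_degreeSum hd S A
    have h2 : (A.filter fun v => 0 < (sphereGraph S).degree v).card ≤ k :=
      (Finset.card_filter_le _ _).trans hAk
    generalize (A.filter fun v => 0 < (sphereGraph S).degree v).card = m at h1 h2
    have hk1 : (1 : ℝ) ≤ k := by exact_mod_cast hk
    have he : 0 ≤ 1 - 1 / (d : ℝ) := by
      rw [sub_nonneg]; exact (div_le_one (by linarith)).2 (by linarith)
    calc (m : ℝ) = (m : ℝ) ^ (1 / (d : ℝ) + (1 - 1 / (d : ℝ))) := by simp
      _ = (m : ℝ) ^ (1 / (d : ℝ)) * (m : ℝ) ^ (1 - 1 / (d : ℝ)) :=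
        Real.rpow_add_of_nonneg (Nat.cast_nonneg _) (by positivity) he
      _ ≤ (k : ℝ) ^ (1 : ℝ) * degreeSum S ^ (1 - 1 / (d : ℝ)) := by
        refine mul_le_mul ?_ (Real.rpow_le_rpow (Nat.cast_nonneg _) h1 he) (by positivity)
          (by positivity)
        calc (m : ℝ) ^ (1 / (d : ℝ)) ≤ (k : ℝ) ^ (1 / (d : ℝ)) :=
              Real.rpow_le_rpow (Nat.cast_nonneg _) (by exact_mod_cast h2) (by positivity)
          _ ≤ (k : ℝ) ^ (1 : ℝ) := Real.rpow_le_rpow_of_exponent_le hk1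
              ((div_le_one (by linarith)).2 (by linarith))
      _ = _ := by rw [Real.rpow_one]
  · refine Finset.card_le_one.2 fun a ha b hb => ?_
    obtain ⟨haY, haA⟩ := Finset.mem_inter.1 ha
    have h0 : (sphereGraph S).degree a = 0 := by
      by_contra h
      exact Finset.disjoint_left.1 hYZ haY (Finset.mem_filter.2 ⟨haA, Nat.pos_of_ne_zero h⟩)
    exact (hY.eq_of_degree_eq_zero haY h0 b (Finset.mem_inter.1 hb).1).symm

open Classical in
/-- **Proportional separators.** Removing few spheres leaves every connected set of spheres without
a fixed proportion of the members of `A`. -/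
theorem exists_proportional_separator {d n : ℕ} (hd : 2 ≤ d)
    (T : Finset (EuclideanSpace ℝ (Fin d)))
    (hT : Metric.closedBall (0 : EuclideanSpace ℝ (Fin d)) 4 ⊆ ⋃ x ∈ T, Metric.closedBall x 1)
    (S : Fin n → EuclideanGeometry.Sphere (EuclideanSpace ℝ (Fin d)))
    (hr : ∀ v, 0 < (S v).radius) (A : Finset (Fin n)) (hA : 2 ≤ A.card) :
    ∃ Z : Finset (Fin n),
      (Z.card : ℝ) ≤ (64 + 2 * T.card : ℕ) * degreeSum S ^ (1 - 1 / (d : ℝ)) ∧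
      ∀ Y, IsConnectedSet (sphereGraph S) Y → Disjoint Y Z →
        A.card + 2 * T.card * (Y ∩ A).card ≤ 2 * T.card * A.card := by
  have hd' : (2 : ℝ) ≤ d := by exact_mod_cast hd
  have hT0 : 0 < T.card := by
    obtain ⟨x, hx, -⟩ := Set.mem_iUnion₂.1 (hT (Metric.mem_closedBall_self (by norm_num)))
    exact Finset.card_pos.2 ⟨x, hx⟩
  rcases le_or_gt A.card (64 + 2 * T.card) with hsmall | hlarge
  · obtain ⟨Z, hZ, hYZ⟩ := exists_separator_of_card_le hd S (by omega) A hsmall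
    refine ⟨Z, hZ, fun Y hY hd => ?_⟩
    have := hYZ Y hY hd
    nlinarith
  have hX := one_lt_rank_euclideanSpace hd
  have : Nonempty (Fin d) := ⟨⟨0, by omega⟩⟩
  let sph : Fin n → Set (EuclideanSpace ℝ (Fin d)) :=
    fun v => Metric.sphere (S v).center (S v).radius
  let G := sphereGraph S
  have hG := disjoint_sphere_of_not_adj S
  have hG' := not_disjoint_sphere_of_adj S
  obtain ⟨p, hp, hpS⟩ := exists_injective_mem_of_infinite sph
    fun v => infinite_sphere hX (S v).center (hr v)
  obtain ⟨c, R, hR, hin, hout⟩ := exists_window T hT A p hp (by omega)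
  obtain ⟨E, F, hside, hhalf, hcov, hE⟩ := exists_sides hX S hr A p
  have hball : ∀ v, ∃ a s : ℝ, 0 ≤ s ∧
      (∀ t ∈ Set.Icc R (2 * R), (closure (E v) ∩ Metric.sphere c t).Nonempty →
        t ∈ Set.Icc a (a + 2 * s)) ∧
      ∃ y, Metric.ball y s ⊆ E v ∩ Metric.ball c (4 * R) := by
    intro v
    rcases hE v with h | h <;> rw [h]
    · exact exists_ball_subset_ball_inter _ c (hr v) hR
    · exact exists_ball_subset_compl_closedBall_inter _ c (hr v) hR
  choose a s hs ha y hy using hball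
  -- the expected cost of a sphere, and the choice of the radius `t`
  let P := exposureProb G E
  let w : Fin n → ℝ := fun v => if 0 < G.degree v then P v else 0
  have hw : ∀ v, 0 ≤ w v := fun v => by
    dsimp only [w]; split_ifs; exacts [exposureProb_nonneg G E v, le_rfl]
  obtain ⟨t, ht, htle⟩ := exists_sum_indicator_Icc_le w a s hw hs hR
  let M : Finset (Fin n) :=
    Finset.univ.filter fun v => (closure (E v) ∩ Metric.sphere c t).Nonempty
  obtain ⟨D, hD⟩ := exists_card_removedVertices_le G hside M
  refine ⟨removedVertices G E D M, ?_, fun Y hY hYZ => ?_⟩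
  · have h1 : ∑ v ∈ M, w v ≤
        ∑ v, (Set.Icc (a v) (a v + 2 * s v)).indicator (fun _ => w v) t := by
      rw [Finset.sum_filter]
      refine Finset.sum_le_sum fun v _ => ?_
      split_ifs with h
      · rw [Set.indicator_of_mem (ha v t ht h)]
      · exact Set.indicator_nonneg (fun _ _ => hw v) _
    have h2 : ∑ v, w v * (s v / R) =
        ∑ v ∈ Finset.univ.filter fun v => 0 < G.degree v, P v * (s v / R) := by
      rw [Finset.sum_filter]
      exact Finset.sum_congr rfl fun v _ => by dsimp only [w]; split_ifs <;> simp
    have hvol := sum_mul_pow_le_of_ball_subset (fun v => samplingProb G v * P v) s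
      (fun v => mul_nonneg (samplingProb_nonneg G v) (exposureProb_nonneg G E v)) hs E
      (fun x => sum_samplingProb_mul_exposureProb_le G hside hG hG' hcov x) c hR y hy
    rw [finrank_euclideanSpace_fin] at hvol
    have hH := sum_mul_le_rpow_mul_rpow (Finset.univ.filter fun v => 0 < G.degree v) hd P
      (fun v => (G.degree v : ℝ)) (fun v => s v / R) (exposureProb_nonneg G E)
      (exposureProb_le_one G E) (fun v hv => by exact_mod_cast (Finset.mem_filter.1 hv).2)
      (fun v => div_nonneg (hs v) hR.le) (fun v => Nat.cast_nonneg _) (B := 2 * 4 ^ d) <| by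
        refine le_trans (Finset.sum_le_sum_of_subset_of_nonneg (Finset.subset_univ _)
          fun v _ _ => ?_) hvol
        exact mul_nonneg (mul_nonneg (samplingProb_nonneg G v) (exposureProb_nonneg G E v))
          (pow_nonneg (div_nonneg (hs v) hR.le) _)
    have he0 : 0 ≤ 1 - 1 / (d : ℝ) := by
      rw [sub_nonneg]; exact (div_le_one (by linarith)).2 (by linarith)
    have hN0 : 0 ≤ degreeSum S :=
      Finset.sum_nonneg fun v _ => Real.rpow_nonneg (Nat.cast_nonneg _) _
    have h3 : (2 * ∑ v ∈ Finset.univ.filter fun v => 0 < G.degree v,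
        (G.degree v : ℝ) ^ (1 / ((d : ℝ) - 1))) ^ (1 - 1 / (d : ℝ)) ≤
          2 * degreeSum S ^ (1 - 1 / (d : ℝ)) := by
      calc _ ≤ (2 * degreeSum S) ^ (1 - 1 / (d : ℝ)) := by
            refine Real.rpow_le_rpow (mul_nonneg zero_le_two (Finset.sum_nonneg fun v _ =>
              Real.rpow_nonneg (Nat.cast_nonneg _) _)) (mul_le_mul_of_nonneg_left ?_ zero_le_two) he0
            exact Finset.sum_le_sum_of_subset_of_nonneg (Finset.subset_univ _)
              fun v _ _ => Real.rpow_nonneg (Nat.cast_nonneg _) _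
        _ = 2 ^ (1 - 1 / (d : ℝ)) * degreeSum S ^ (1 - 1 / (d : ℝ)) :=
            Real.mul_rpow zero_le_two hN0
        _ ≤ _ := by
            refine mul_le_mul_of_nonneg_right ?_ (Real.rpow_nonneg hN0 _)
            calc (2 : ℝ) ^ (1 - 1 / (d : ℝ)) ≤ 2 ^ (1 : ℝ) :=
                  Real.rpow_le_rpow_of_exponent_le one_le_two (by
                    have : 0 ≤ 1 / (d : ℝ) := by positivity
                    linarith)
              _ = 2 := Real.rpow_one 2
    have h4 : (2 * 4 ^ d : ℝ) ^ (1 / (d : ℝ)) ≤ 8 := by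
      calc (2 * 4 ^ d : ℝ) ^ (1 / (d : ℝ)) ≤ (8 ^ d) ^ (1 / (d : ℝ)) := by
            refine Real.rpow_le_rpow (by positivity) ?_ (by positivity)
            calc (2 : ℝ) * 4 ^ d ≤ 2 ^ d * 4 ^ d := by
                  refine mul_le_mul_of_nonneg_right ?_ (by positivity)
                  exact le_self_pow₀ one_le_two (by omega)
              _ = 8 ^ d := by rw [← mul_pow]; norm_num
        _ = 8 := by rw [one_div, Real.pow_rpow_inv_natCast (by norm_num) (by omega)]
    have h5 : ∑ v, w v * (s v / R) ≤ 2 * degreeSum S ^ (1 - 1 / (d : ℝ)) * 8 := by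
      rw [h2]
      exact hH.trans (mul_le_mul h3 h4 (by positivity)
        (mul_nonneg zero_le_two (Real.rpow_nonneg hN0 _)))
    have h6 : 0 ≤ degreeSum S ^ (1 - 1 / (d : ℝ)) := Real.rpow_nonneg hN0 _
    have h7 : (0 : ℝ) ≤ T.card := Nat.cast_nonneg _
    have hD' : ((removedVertices G E D M).card : ℝ) ≤ 2 * ∑ v ∈ M, w v := hD
    push_cast
    nlinarith
  · have hfin : 2 * (Y ∩ A).card ≤ A.card →
        A.card + 2 * T.card * (Y ∩ A).card ≤ 2 * T.card * A.card := fun h => by nlinarith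
    rcases hY.confined_of_disjoint_removedVertices hside hG hG' (Metric.sphere c t) D Y hYZ with
      h | ⟨u, hu⟩ | h
    · exact hfin (by linarith [Finset.card_le_card (Finset.inter_subset_left (s₁ := Y) (s₂ := A))])
    · refine hfin (le_trans (Nat.mul_le_mul_left 2 (Finset.card_le_card fun v hv => ?_)) (hhalf u))
      obtain ⟨hvY, hvA⟩ := Finset.mem_inter.1 hv
      exact Finset.mem_filter.2 ⟨hvA, hu v hvY (hpS v)⟩
    have hcut := isSidePair_sphere hX c (hR.trans_le ht.1)
    by_cases hI : ∃ v ∈ Y, sph v ⊆ Metric.ball c t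
    · have hall := hY (fun v => sph v ⊆ Metric.ball c t) (fun u _ v hv huv hu => by
        obtain ⟨z, hzu, hzv⟩ := Set.not_disjoint_iff.1 (hG' u v huv)
        exact hcut.subset_left (hside v).isPreconnected (h v hv) hzv (hu hzu)) hI
      refine hfin (le_trans (Nat.mul_le_mul_left 2 (Finset.card_le_card fun v hv => ?_)) hout)
      obtain ⟨hvY, hvA⟩ := Finset.mem_inter.1 hv
      have := hall v hvY (hpS v)
      rw [Metric.mem_ball] at this
      exact Finset.mem_filter.2 ⟨hvA, Metric.mem_closedBall.2 (by linarith [ht.2])⟩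
    · push Not at hI
      have hdis : Disjoint (Y ∩ A) (A.filter fun v => p v ∈ Metric.closedBall c R) := by
        refine Finset.disjoint_left.2 fun v hv hv' => ?_
        have hvY := (Finset.mem_inter.1 hv).1
        have h1 := ((hcut.subset_or_subset (hside v).isPreconnected (h v hvY)).resolve_left
          (hI v hvY)) (hpS v)
        have h2 := Metric.mem_closedBall.1 (Finset.mem_filter.1 hv').2
        simp only [Set.mem_compl_iff, Metric.mem_closedBall, not_le] at h1
        linarith [ht.1]
      have h1 := Finset.card_le_card (Finset.union_subset (Finset.inter_subset_right (s₁ := Y))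
        (Finset.filter_subset (fun v => p v ∈ Metric.closedBall c R) A))
      rw [Finset.card_union_of_disjoint hdis] at h1
      nlinarith

/-! ### Balanced separators -/

open Classical in
/-- Cut the largest connected set repeatedly by proportional separators, until all connected sets are
small. -/
theorem exists_iterated_separator {d n : ℕ} (hd : 2 ≤ d) (hn : n ≠ 1)
    (T : Finset (EuclideanSpace ℝ (Fin d)))
    (hT : Metric.closedBall (0 : EuclideanSpace ℝ (Fin d)) 4 ⊆ ⋃ x ∈ T, Metric.closedBall x 1)
    (S : Fin n → EuclideanGeometry.Sphere (EuclideanSpace ℝ (Fin d)))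
    (hr : ∀ v, 0 < (S v).radius) (j : ℕ) :
    ∃ Z : Finset (Fin n),
      (Z.card : ℝ) ≤ j * ((64 + 2 * T.card : ℕ) * degreeSum S ^ (1 - 1 / (d : ℝ))) ∧
      ∀ Y, IsConnectedSet (sphereGraph S) Y → Disjoint Y Z →
        (Y.card : ℝ) ≤ 2 / 3 * n ∨ (Y.card : ℝ) ≤ (1 - 1 / (2 * T.card)) ^ j * n := by
  induction j with
  | zero =>
    refine ⟨∅, by simp, fun Y _ _ => Or.inr ?_⟩
    have := Y.card_le_univ
    rw [Fintype.card_fin] at this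
    simpa using this
  | succ j ih =>
    obtain ⟨Z, hZ, hZY⟩ := ih
    have hB : 0 ≤ (64 + 2 * T.card : ℕ) * degreeSum S ^ (1 - 1 / (d : ℝ)) :=
      mul_nonneg (Nat.cast_nonneg _) (Real.rpow_nonneg
        (Finset.sum_nonneg fun v _ => Real.rpow_nonneg (Nat.cast_nonneg _) _) _)
    by_cases hbig : ∃ Y, IsConnectedSet (sphereGraph S) Y ∧ Disjoint Y Z ∧ 2 / 3 * (n : ℝ) < Y.card
    swap
    · push Not at hbig
      refine ⟨Z, hZ.trans ?_, fun Y hY hd => Or.inl (hbig Y hY hd)⟩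
      exact mul_le_mul_of_nonneg_right (by push_cast; linarith) hB
    obtain ⟨Y₀, hY₀, hmax⟩ := (Finset.univ.filter fun Y : Finset (Fin n) =>
        IsConnectedSet (sphereGraph S) Y ∧ Disjoint Y Z ∧ 2 / 3 * (n : ℝ) < Y.card).exists_max_image
      Finset.card (hbig.imp fun Y h => Finset.mem_filter.2 ⟨Finset.mem_univ _, h⟩)
    obtain ⟨-, hconn, hdis, hlarge⟩ := Finset.mem_filter.1 hY₀
    have hcard : Y₀.card ≤ n := by simpa using Y₀.card_le_univ
    have h2 : 2 ≤ Y₀.card := by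
      have h0 : Y₀.card ≠ 0 := by
        intro h
        rw [h, Nat.cast_zero] at hlarge
        linarith [(Nat.cast_nonneg n : (0 : ℝ) ≤ n)]
      have h1 : Y₀.card ≠ 1 := by
        intro h
        rw [h, Nat.cast_one] at hlarge
        have : (2 : ℝ) ≤ n := by exact_mod_cast (show 2 ≤ n by omega)
        linarith
      omega
    obtain ⟨Z', hZ', hZY'⟩ := exists_proportional_separator hd T hT S hr Y₀ h2
    refine ⟨Z ∪ Z', ?_, fun Y hY hYZ => ?_⟩
    · have h3 : ((Z ∪ Z').card : ℝ) ≤ Z.card + Z'.card := by exact_mod_cast Finset.card_union_le _ _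
      push_cast at hZ hZ' ⊢
      linarith
    rw [Finset.disjoint_union_right] at hYZ
    by_cases hmeet : Disjoint Y Y₀
    · refine Or.inl ?_
      have h4 := (Y ∪ Y₀).card_le_univ
      rw [Finset.card_union_of_disjoint hmeet, Fintype.card_fin] at h4
      have h5 : (Y.card : ℝ) + Y₀.card ≤ n := by exact_mod_cast h4
      linarith [(Nat.cast_nonneg n : (0 : ℝ) ≤ n)]
    · obtain ⟨x, hxY, hxY₀⟩ := Finset.not_disjoint_iff.1 hmeet
      -- `Y₀` is a maximal connected set, so it contains `Y`
      have hunion : IsConnectedSet (sphereGraph S) (Y ∪ Y₀) := by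
        intro P hP ⟨a, ha, hPa⟩
        have hx : P x := by
          rcases Finset.mem_union.1 ha with ha | ha
          · exact hY P (fun u hu v hv => hP u (Finset.mem_union_left _ hu) v
              (Finset.mem_union_left _ hv)) ⟨a, ha, hPa⟩ x hxY
          · exact hconn P (fun u hu v hv => hP u (Finset.mem_union_right _ hu) v
              (Finset.mem_union_right _ hv)) ⟨a, ha, hPa⟩ x hxY₀
        intro b hb
        rcases Finset.mem_union.1 hb with hb | hb
        · exact hY P (fun u hu v hv => hP u (Finset.mem_union_left _ hu) v
            (Finset.mem_union_left _ hv)) ⟨x, hxY, hx⟩ b hb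
        · exact hconn P (fun u hu v hv => hP u (Finset.mem_union_right _ hu) v
            (Finset.mem_union_right _ hv)) ⟨x, hxY₀, hx⟩ b hb
      have hle := hmax (Y ∪ Y₀) (Finset.mem_filter.2 ⟨Finset.mem_univ _, hunion,
        Finset.disjoint_union_left.2 ⟨hYZ.1, hdis⟩, hlarge.trans_le (by
          exact_mod_cast Finset.card_le_card Finset.subset_union_right)⟩)
      have hsub : Y ⊆ Y₀ := Finset.union_eq_right.1
        (Finset.eq_of_subset_of_card_le Finset.subset_union_right hle).symm
      have hT0 : 0 < T.card := by
        obtain ⟨x, hx, -⟩ := Set.mem_iUnion₂.1 (hT (Metric.mem_closedBall_self (by norm_num)))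
        exact Finset.card_pos.2 ⟨x, hx⟩
      have hT1 : (1 : ℝ) ≤ T.card := by exact_mod_cast hT0
      have h6 := hZY' Y hY hYZ.2
      rw [Finset.inter_eq_left.2 hsub] at h6
      have h7 : (Y₀.card : ℝ) + 2 * T.card * Y.card ≤ 2 * T.card * Y₀.card := by exact_mod_cast h6
      have h8 : (Y.card : ℝ) ≤ (1 - 1 / (2 * T.card)) * Y₀.card := by
        have : (1 - 1 / (2 * (T.card : ℝ))) * Y₀.card =
            (2 * T.card * Y₀.card - Y₀.card) / (2 * T.card) := by field_simp
        rw [this, le_div_iff₀ (by positivity)]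
        linarith
      have h9 : 0 ≤ 1 - 1 / (2 * (T.card : ℝ)) := by
        rw [sub_nonneg, div_le_one (by positivity)]; linarith
      rcases hZY Y₀ hconn hdis with h | h
      · exact absurd h hlarge.not_ge
      · refine Or.inr (h8.trans ?_)
        rw [pow_succ', mul_assoc]
        exact mul_le_mul_of_nonneg_left h h9

/-- The vertex set of a component of `G \ X` is connected in `G`. -/
theorem isBalancedSeparator_of_isConnectedSet {V : Type*} [Fintype V] {G : SimpleGraph V}
    {X : Finset V} (h : ∀ Y, IsConnectedSet G Y → Disjoint Y X →
      (Y.card : ℝ) ≤ 2 / 3 * Fintype.card V) : IsBalancedSeparator G X := by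
  classical
  intro K
  let Y : Finset V := (Subtype.val '' K.supp).toFinset
  have hmem : ∀ v, v ∈ Y ↔ ∃ hv : v ∉ X, (⟨v, hv⟩ : {v : V | v ∉ X}) ∈ K.supp := by
    intro v; simp [Y]
  have hcard : K.supp.ncard = Y.card := by
    rw [← Set.ncard_image_of_injective K.supp Subtype.val_injective, Set.ncard_eq_toFinset_card']
  rw [hcard]
  refine h Y (fun P hP ⟨a, ha, hPa⟩ b hb => ?_) (Finset.disjoint_left.2 fun v hv =>
    ((hmem v).1 hv).1)
  obtain ⟨haX, haK⟩ := (hmem a).1 ha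
  obtain ⟨hbX, hbK⟩ := (hmem b).1 hb
  rw [SimpleGraph.ConnectedComponent.mem_supp_iff] at haK hbK
  have hreach := SimpleGraph.ConnectedComponent.exact (haK.trans hbK.symm)
  rw [SimpleGraph.reachable_iff_reflTransGen] at hreach
  have key : ∀ z, Relation.ReflTransGen (G.induce {v : V | v ∉ X}).Adj ⟨a, haX⟩ z →
      P z.1 ∧ z ∈ K.supp := by
    intro z hz
    induction hz with
    | refl => exact ⟨hPa, haK⟩
    | tail _ hadj ih =>
      have hz := (SimpleGraph.ConnectedComponent.mem_supp_congr_adj K hadj).1 ih.2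
      exact ⟨hP _ ((hmem _).2 ⟨_, ih.2⟩) _ ((hmem _).2 ⟨_, hz⟩) hadj ih.1, hz⟩
  exact (key _ hreach).1

/-- The power mean inequality for the degrees, together with the handshake lemma. -/
theorem degreeSum_rpow_le {d n : ℕ} (hd : 2 ≤ d)
    (S : Fin n → EuclideanGeometry.Sphere (EuclideanSpace ℝ (Fin d))) :
    degreeSum S ^ (1 - 1 / (d : ℝ)) ≤
      2 * (((sphereGraph S).edgeFinset.card : ℝ) ^ (1 / (d : ℝ)) * (n : ℝ) ^ (1 - 2 / (d : ℝ))) := by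
  have hd' : (2 : ℝ) ≤ d := by exact_mod_cast hd
  have hd1 : (d : ℝ) - 1 ≠ 0 := by linarith
  have hd0 : (d : ℝ) ≠ 0 := by linarith
  have hn0 : (0 : ℝ) ≤ n := Nat.cast_nonneg n
  let m := (sphereGraph S).edgeFinset.card
  have hm0 : (0 : ℝ) ≤ m := Nat.cast_nonneg m
  have hsum : ∑ i, ((sphereGraph S).degree i : ℝ) = 2 * m := by
    exact_mod_cast (sphereGraph S).sum_degrees_eq_twice_card_edges
  have h := Real.inner_le_weight_mul_Lp_of_nonneg Finset.univ (p := (d : ℝ) - 1) (by linarith)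
    (fun _ : Fin n => 1) (fun i => ((sphereGraph S).degree i : ℝ) ^ (1 / ((d : ℝ) - 1)))
    (fun _ => zero_le_one) (fun _ => Real.rpow_nonneg (Nat.cast_nonneg _) _)
  have hpow : ∀ i, (((sphereGraph S).degree i : ℝ) ^ (1 / ((d : ℝ) - 1))) ^ ((d : ℝ) - 1) =
      (sphereGraph S).degree i := fun i => by
    rw [one_div, Real.rpow_inv_rpow (Nat.cast_nonneg _) hd1]
  simp only [one_mul, hpow, hsum, Finset.sum_const, Finset.card_univ, Fintype.card_fin,
    nsmul_eq_mul, mul_one] at h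
  have he0 : 0 ≤ 1 - 1 / (d : ℝ) := by
    rw [sub_nonneg]; exact (div_le_one (by linarith)).2 (by linarith)
  calc degreeSum S ^ (1 - 1 / (d : ℝ))
      ≤ ((n : ℝ) ^ (1 - ((d : ℝ) - 1)⁻¹) * (2 * m) ^ ((d : ℝ) - 1)⁻¹) ^ (1 - 1 / (d : ℝ)) :=
        Real.rpow_le_rpow (Finset.sum_nonneg fun v _ => Real.rpow_nonneg (Nat.cast_nonneg _) _) h
          he0
    _ = (n : ℝ) ^ (1 - 2 / (d : ℝ)) * (2 * m) ^ (1 / (d : ℝ)) := by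
        rw [Real.mul_rpow (by positivity) (by positivity), ← Real.rpow_mul hn0,
          ← Real.rpow_mul (by positivity)]
        congr 2
        · field_simp; ring
        · field_simp
    _ ≤ (n : ℝ) ^ (1 - 2 / (d : ℝ)) * (2 * (m : ℝ) ^ (1 / (d : ℝ))) := by
        refine mul_le_mul_of_nonneg_left ?_ (by positivity)
        rw [Real.mul_rpow zero_le_two hm0]
        refine mul_le_mul_of_nonneg_right ?_ (by positivity)
        calc (2 : ℝ) ^ (1 / (d : ℝ)) ≤ 2 ^ (1 : ℝ) :=
              Real.rpow_le_rpow_of_exponent_le one_le_two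
                ((div_le_one (by linarith)).2 (by linarith))
          _ = 2 := Real.rpow_one 2
    _ = _ := by ring

theorem theorem3p1 (d : ℕ) (hd : 2 ≤ d) :
    ∃ C : ℝ, 0 < C ∧
      ∀ (n : ℕ), n ≠ 1 →
        ∀ S : Fin n → EuclideanGeometry.Sphere (EuclideanSpace ℝ (Fin d)),
          (∀ i, 0 < (S i).radius) →
            (∃ X : Finset (Fin n), IsBalancedSeparator (sphereGraph S) X ∧
              (X.card : ℝ) ≤
                C * (∑ i, ((sphereGraph S).degree i : ℝ) ^ (1 / ((d : ℝ) - 1))) ^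
                  (1 - 1 / (d : ℝ))) ∧
            (∃ X : Finset (Fin n), IsBalancedSeparator (sphereGraph S) X ∧
              (X.card : ℝ) ≤
                C * ((sphereGraph S).edgeFinset.card : ℝ) ^ (1 / (d : ℝ)) *
                  (n : ℝ) ^ (1 - 2 / (d : ℝ))) := by
  obtain ⟨T, hT⟩ := exists_finset_cover_closedBall (E := EuclideanSpace ℝ (Fin d))
  have hT0 : (0 : ℝ) < T.card := by
    obtain ⟨x, hx, -⟩ := Set.mem_iUnion₂.1 (hT (Metric.mem_closedBall_self (by norm_num)))
    exact_mod_cast Finset.card_pos.2 ⟨x, hx⟩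
  -- the number of rounds after which the proportional separators have reached `2 / 3`
  obtain ⟨j, hj⟩ := exists_pow_lt_of_lt_one (show (0 : ℝ) < 2 / 3 by norm_num)
    (show 1 - 1 / (2 * (T.card : ℝ)) < 1 by
      have : 0 < 1 / (2 * (T.card : ℝ)) := by positivity
      linarith)
  refine ⟨2 * (j + 1) * (64 + 2 * T.card : ℕ), by positivity, fun n hn S hr => ?_⟩
  obtain ⟨X, hX, hsep⟩ := exists_iterated_separator hd hn T hT S hr j
  have hbal : IsBalancedSeparator (sphereGraph S) X := by
    refine isBalancedSeparator_of_isConnectedSet fun Y hY hYX => ?_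
    rw [Fintype.card_fin]
    exact (hsep Y hY hYX).elim id fun h => h.trans
      (mul_le_mul_of_nonneg_right hj.le (Nat.cast_nonneg n))
  have hN : 0 ≤ degreeSum S ^ (1 - 1 / (d : ℝ)) := Real.rpow_nonneg
    (Finset.sum_nonneg fun v _ => Real.rpow_nonneg (Nat.cast_nonneg _) _) _
  have hk : (0 : ℝ) ≤ (64 + 2 * T.card : ℕ) := Nat.cast_nonneg _
  have hj0 : (0 : ℝ) ≤ j := Nat.cast_nonneg j
  refine ⟨⟨X, hbal, hX.trans ?_⟩, ⟨X, hbal, hX.trans ?_⟩⟩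
  · rw [← mul_assoc]
    exact mul_le_mul_of_nonneg_right (mul_le_mul_of_nonneg_right (by linarith) hk) hN
  · calc (j : ℝ) * ((64 + 2 * T.card : ℕ) * degreeSum S ^ (1 - 1 / (d : ℝ)))
        ≤ (j + 1) * ((64 + 2 * T.card : ℕ) * degreeSum S ^ (1 - 1 / (d : ℝ))) :=
          mul_le_mul_of_nonneg_right (by linarith) (mul_nonneg hk hN)
      _ ≤ (j + 1) * ((64 + 2 * T.card : ℕ) *
          (2 * (((sphereGraph S).edgeFinset.card : ℝ) ^ (1 / (d : ℝ)) *
            (n : ℝ) ^ (1 - 2 / (d : ℝ))))) :=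
          mul_le_mul_of_nonneg_left (mul_le_mul_of_nonneg_left (degreeSum_rpow_le hd S) hk)
            (by linarith)
      _ = _ := by ring
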